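/- Let $q>1$ be an integer, let $\mathbf G=(\mathbb Z/q\mathbb Z)^\times$, and let $\mathscr G$ be the set of cyclic subgroups of $\mathbf G$. A *lattice-invariant class* is a set of the form $\{x\in\mathbf G:\langle x\rangle=K\}$ with $K\in\mathscr G$; let $\mathbf G^\sharp$ be the set of these classes, which is in bijection with $\mathscr G$ through $\mathcal A\mapsto\langle\mathcal A\rangle$. Let $\exp\mathbf G$ be the exponent of $\mathbf G$, let $d(n)$ be the number of positive divisors of $n$, and let $\mu$ be the Möbius function. For real $P\ge 2$, real $s>1$ and a Dirichlet character $\chi$ modulo $q$, put $L_P(s,\chi)=\prod_{p\ge P}(1-\chi(p)p^{-s})^{-1}$ (product over primes). For $t\ge1$ let $\Gamma_s(t)$ be the vector indexed by $G_0\in\mathscr G$ with entries $$\log\prod_{\chi\in G_0^\perp}L_P(ts,\chi),$$ where $G_0^\perp$ is the group of Dirichlet characters modulo $q$ that are equal to $1$ on $G_0$ (the product is a positive real number). Let $M_1^{-1}$ be the matrix with rows indexed by $\mathcal A\in\mathbf G^\sharp$ and columns by $K\in\mathscr G$, whose entry is $\mu(|\langle\mathcal A\rangle/K|)/|\mathbf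 G/K|$ if $K\subset\langle\mathcal A\rangle$ and $0$ otherwise. For each divisor $d>1$ of $\exp\mathbf G$ let $N_d$ be the matrix indexed by $\mathscr G\times\mathscr G$ with entries $$N_d\big|_{B_0,B_1}=\sum_{K\subset B_0,\ |KB_1/K|=d}\mu(|B_0/K|).$$ Identifying $\mathbf G^\sharp$ with $\mathscr G$, define for $r\ge2$ the positive numbers $\zeta_P(s;q,\mathcal A|r)$ by $$\bigl(\log\zeta_P(s;q,\mathcal A|r)\bigr)_{\mathcal A\in\mathbf G^\sharp}=\sum_{0\le v\le r-1}(-1)^v\sum_{d_1\cdots d_v\le 2^r}\frac{N_{d_1}}{d_1}\cdots\frac{N_{d_v}}{d_v}M_1^{-1}\Gamma_s(d_1\cdots d_v),$$ where $d_1,\dots,d_v$ range over the divisors of $\exp\mathbf G$ other than $1$ (for $v=0$ the inner sum is $M_1^{-1}\Gamma_s(1)$). For $F\in\mathbb R[X]$ with $F(0)=1$, let $\alpha_1,\dots,\alpha_\delta$ be the inverses of its complex roots, counted with multiplicity, and put $s_F(k)=\alpha_1^k+\dots+\alpha_\delta^k$ and $b_F(k)=\frac1k\sum_{d\mid k}\mu(k/d)\,s_F(d)$.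 These are real numbers. **Theorem.** Let $F,G\in\mathbb R[X]$ be two coprime polynomials with $F(0)=G(0)=1$ and $X^2\mid F-G$. Let $\beta\ge2$ be an upper bound for the moduli of the inverses of the complex roots of $F$ and of $G$, and let $P\ge2\beta$ be a real number. Let $\mathcal A\in\mathbf G^\sharp$. Then, for all integers $J\ge3$ and $r\ge2$, the product on the left below converges and $$\prod_{\substack{p\ge P\\ p\bmod q\,\in\mathcal A}}\frac{F(1/p)}{G(1/p)}=\prod_{2\le j\le J}\zeta_P(j;q,\mathcal A|r)^{b_G(j)-b_F(j)}\times I,$$ where $I>0$ satisfies $$|\log I|\le\max(\deg F,\deg G)\left(\left(\frac{|\mathbf G^\sharp|\,d(\exp\mathbf G)}{2}\right)^{r-1}\frac{r\beta^2}{P^{2^{r+1}}}\,(1+2^{-r}P)+\frac{4\beta^{J+1}}{J\,P^{J}}\right).$$ -/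

import Mathlib

namespace EulerProd

/-- The group `G = (ℤ/qℤ)ˣ`. -/
abbrev G (q : ℕ) : Type := (ZMod q)ˣ

/-- The set `𝒢` of cyclic subgroups of `G`. -/
abbrev CyclicSubgroup (q : ℕ) : Type := {K : Subgroup (G q) // IsCyclic K}

/-- The set of generators of a subgroup `K`. -/
def generators {q : ℕ} (K : Subgroup (G q)) : Set (G q) := {x | Subgroup.zpowers x = K}

/-- The set `G^♯` of lattice-invariant classes: the sets of all generators of a cyclic
subgroup of `G`. -/
abbrev LatticeClass (q : ℕ) : Type :=
  {A : Set (G q) // ∃ K : Subgroup (G q), IsCyclic K ∧ A = generators K}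

theorem closure_generators {q : ℕ} (K : Subgroup (G q)) (hK : IsCyclic K) :
    Subgroup.closure (generators K) = K := by
  apply le_antisymm
  · rw [Subgroup.closure_le]
    intro x hx
    have hx' : Subgroup.zpowers x = K := hx
    rw [← hx']
    exact Subgroup.mem_zpowers x
  · obtain ⟨g, hg⟩ := (Subgroup.isCyclic_iff_exists_zpowers_eq_top K).1 hK
    have h : g ∈ Subgroup.closure (generators K) := Subgroup.subset_closure hg
    exact hg.symm.le.trans ((Subgroup.zpowers_le).2 h)

/-- The cyclic subgroup `⟨A⟩` generated by a lattice-invariant class `A`. The map `A ↦ ⟨A⟩` is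
the bijection between lattice-invariant classes and cyclic subgroups. -/
def LatticeClass.span {q : ℕ} (A : LatticeClass q) : CyclicSubgroup q :=
  ⟨Subgroup.closure A.1, by
    obtain ⟨K, hK, hA⟩ := A.2
    rw [hA, closure_generators K hK]
    exact hK⟩

noncomputable instance (q : ℕ) [NeZero q] : Fintype (CyclicSubgroup q) := Fintype.ofFinite _

/-- `L_P(s, χ) = ∏_{p ≥ P} (1 - χ(p) / p ^ s)⁻¹`, over primes, for real `s > 1`. -/
noncomputable def LP {q : ℕ} (P s : ℝ) (χ : DirichletCharacter ℂ q) : ℂ :=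
  ∏' p : {p : ℕ // p.Prime ∧ P ≤ (p : ℝ)}, (1 - χ (p.1 : ZMod q) / (p.1 : ℂ) ^ (s : ℂ))⁻¹

open Classical in
/-- `G₀^⊥`: the Dirichlet characters modulo `q` that take the value `1` on `G₀`. -/
noncomputable def perp {q : ℕ} [NeZero q] (G₀ : Subgroup (G q)) :
    Finset (DirichletCharacter ℂ q) :=
  Finset.univ.filter fun χ => ∀ g ∈ G₀, χ (g : ZMod q) = 1

/-- `Γ_s(t)`, the vector with entries `γ_s(G₀, t) = log ∏_{χ ∈ G₀^⊥} L_P(t s, χ)`, for `G₀` a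
cyclic subgroup. The product is a positive real number, because `G₀^⊥` is stable under complex
conjugation; `re` only moves it from `ℂ` to `ℝ`. -/
noncomputable def Gam {q : ℕ} [NeZero q] (P s : ℝ) (t : ℕ) : CyclicSubgroup q → ℝ :=
  fun G₀ => Real.log (∏ χ ∈ perp G₀.1, LP P ((t : ℝ) * s) χ).re

open Classical in
/-- The matrix `M₁⁻¹`. Its rows are indexed by lattice-invariant classes `A`; the row of `A` is
given here the index `B = ⟨A⟩`. The entry is `μ(|B/K|) / |G/K|` if `K ⊆ B`, and `0` otherwise. -/
noncomputable def M1inv (q : ℕ) : Matrix (CyclicSubgroup q) (CyclicSubgroup q) ℝ :=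
  fun B K =>
    if K.1 ≤ B.1 then (ArithmeticFunction.moebius (K.1.relIndex B.1) : ℝ) / (K.1.index : ℝ)
    else 0

/-- The matrix `N_d`, with entries `∑ μ(|B₀/K|)` over the subgroups `K ⊆ B₀` such that
`|K B₁ / K| = d`. -/
noncomputable def N (q : ℕ) (d : ℕ) :
    Matrix (CyclicSubgroup q) (CyclicSubgroup q) ℝ :=
  fun B₀ B₁ =>
    ∑ᶠ K ∈ {K : Subgroup (G q) | K ≤ B₀.1 ∧ K.relIndex (K ⊔ B₁.1) = d},
      (ArithmeticFunction.moebius (K.relIndex B₀.1) : ℝ)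

/-- The exponent of `G`. -/
noncomputable def expG (q : ℕ) : ℕ := Monoid.exponent (G q)

/-- The tuples `(d₁, …, d_v)` of divisors of `exp G`, all distinct from `1`, such that
`d₁ ⋯ d_v ≤ 2 ^ r`. -/
noncomputable def tuples (q r v : ℕ) : Finset (Fin v → ℕ) :=
  (Fintype.piFinset fun _ : Fin v => (expG q).divisors.erase 1).filter
    fun d => ∏ i, d i ≤ 2 ^ r

open Classical in
/-- The vector
`∑_{0 ≤ v ≤ r-1} (-1)^v ∑_{d₁ ⋯ d_v ≤ 2^r} (N_{d₁}/d₁) ⋯ (N_{d_v}/d_v) M₁⁻¹ Γ_s(d₁ ⋯ d_v)`. -/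
noncomputable def approxVec (q : ℕ) [NeZero q] (P s : ℝ) (r : ℕ) : CyclicSubgroup q → ℝ :=
  ∑ v ∈ Finset.range r, (-1 : ℝ) ^ v • ∑ d ∈ tuples q r v,
    ((List.ofFn fun i : Fin v => ((d i : ℝ)⁻¹) • N q (d i)).prod * M1inv q).mulVec
      (Gam P s (∏ i, d i))

/-- `ζ_P(s; q, A | r)`. -/
noncomputable def zetaApprox {q : ℕ} [NeZero q] (P s : ℝ) (A : LatticeClass q) (r : ℕ) : ℝ :=
  Real.exp (approxVec q P s r A.span)

open Polynomial in
/-- `s_F(k) = α₁ ^ k + ⋯ + α_δ ^ k`, where the `α_i` are the inverses of the complex roots of `F`,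
counted with multiplicity. This sum is real, because `F` has real coefficients. -/
noncomputable def powerSum (F : ℝ[X]) (k : ℕ) : ℝ :=
  (((F.aroots ℂ).map fun ρ => ρ⁻¹ ^ k).sum).re

open Polynomial in
/-- `b_F(k) = (1/k) ∑_{d ∣ k} μ(k/d) s_F(d)`. -/
noncomputable def wittExp (F : ℝ[X]) (k : ℕ) : ℝ :=
  1 / (k : ℝ) * ∑ d ∈ k.divisors, (ArithmeticFunction.moebius (k / d) : ℝ) * powerSum F d

/-- The primes `p ≥ P` whose residue class modulo `q` lies in `A`. -/
abbrev PrimesIn {q : ℕ} (P : ℝ) (A : LatticeClass q) : Type :=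
  {p : ℕ // p.Prime ∧ P ≤ (p : ℝ) ∧ ∃ a ∈ A.1, (a : ZMod q) = (p : ZMod q)}

end EulerProd

/-!
Let `Z_B(u)` be the sum of `-log (1 - p ^ (-u))` over the primes `p ≥ P` whose residue class
generates the cyclic subgroup `B` (`logZeta (classPrimes P B) u`). Since
`F(x) = ∏ (1 - x ^ j) ^ b_F(j)`, the logarithm of the product over the class `A` is
`∑_j (b_G(j) - b_F(j)) Z_{⟨A⟩}(j)`, where the terms `j ≤ 1` vanish because `X ^ 2 ∣ F - G`.

Orthogonality of characters expresses `Γ_s(t)` in terms of the vectors `Z(u)`, and Möbius inversion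
over the subgroups of a cyclic group gives `M₁⁻¹ Γ_s(t) = ∑_{d ∣ exp G} (N_d / d) Z(d t s)` with
`N_1 = 1`. Solving for `Z(t s)` and substituting the result into itself produces the alternating
sum that defines `ζ_P(s; q, A | r)`. What is cut off are terms containing `Z(u s)` with
`u ≥ 2 ^ r`, each step of the recursion at least doubling `u`. They are small because `Z(u)`
decays like `P ^ (1 - u)`, and since the classes are disjoint, the sum of `Z_B(u)` over all `B`
obeys the same bound.
-/

namespace EulerProd

/-! ### Logarithms of Euler factors -/

theorem neg_log_one_sub_le {x c : ℝ} (h0 : 0 ≤ x) (hc : x ≤ c) (h1 : c < 1) :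
    -Real.log (1 - x) ≤ (1 - c)⁻¹ * x := by
  have hx : 0 < 1 - x := by linarith
  have h_eq : (1 - x)⁻¹ - 1 = (1 - x)⁻¹ * x := by field_simp; ring
  have h_inv : (1 - x)⁻¹ ≤ (1 - c)⁻¹ := inv_anti₀ (by linarith) (by linarith)
  linarith [mul_le_mul_of_nonneg_right h_inv h0, Real.one_sub_inv_le_log_of_pos hx]

theorem neg_log_one_sub_mul_le {x t : ℝ} (h1 : x < 1) (ht0 : 0 ≤ t) (ht1 : t ≤ 1) :
    -Real.log (1 - t * x) ≤ t * -Real.log (1 - x) := by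
  have hx : 0 < 1 - x := by linarith
  have h_bernoulli : (1 - x) ^ t ≤ 1 - t * x := by
    simpa only [mul_neg, ← sub_eq_add_neg] using
      rpow_one_add_le_one_add_mul_self (s := -x) (by linarith) ht0 ht1
  have h_log := Real.log_le_log (Real.rpow_pos_of_pos hx t) h_bernoulli
  rw [Real.log_rpow hx] at h_log
  linarith

/-- The logarithm of the Euler factor `(1 - n⁻ᵘ)⁻¹`. -/
noncomputable def eulerLog (u n : ℕ) : ℝ := -Real.log (1 - 1 / (n : ℝ) ^ u)

theorem one_div_natCast_pow_le_one (n u : ℕ) : 1 / (n : ℝ) ^ u ≤ 1 := by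
  simpa only [one_div, Nat.cast_pow] using Nat.cast_inv_le_one (α := ℝ) (n ^ u)

theorem one_div_natCast_pow_lt_one {n u : ℕ} (hn : 1 < n) (hu : u ≠ 0) :
    1 / (n : ℝ) ^ u < 1 := by
  have hn' : (1 : ℝ) < n := by exact_mod_cast hn
  rw [div_lt_one (by positivity)]
  exact one_lt_pow₀ hn' hu

theorem eulerLog_nonneg (u n : ℕ) : 0 ≤ eulerLog u n := by
  have h0 : 0 ≤ 1 / (n : ℝ) ^ u := by positivity
  have h1 := one_div_natCast_pow_le_one n u
  exact neg_nonneg.2 (Real.log_nonpos (by linarith) (by linarith))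

theorem summable_one_div_natCast_pow {u : ℕ} (hu : 2 ≤ u) (S : Set ℕ) :
    Summable fun n : S => 1 / (n : ℝ) ^ u :=
  (Real.summable_one_div_nat_pow.2 hu).subtype S

theorem summable_eulerLog {u : ℕ} (hu : 2 ≤ u) : Summable (eulerLog u) := by
  have h := Real.summable_log_one_add_of_summable (Real.summable_one_div_nat_pow.2 hu).neg
  exact h.neg.congr fun n => by rw [eulerLog, sub_eq_add_neg]

theorem one_div_natCast_pow_le {n u : ℕ} (hn : 4 ≤ n) (hu : 2 ≤ u) :
    1 / (n : ℝ) ^ u ≤ 1 / 16 := by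
  have hn' : (4 : ℝ) ≤ n := by exact_mod_cast hn
  refine one_div_le_one_div_of_le (by norm_num) ?_
  calc (16 : ℝ) = 4 ^ 2 := by norm_num
    _ ≤ (n : ℝ) ^ 2 := by gcongr
    _ ≤ (n : ℝ) ^ u := pow_le_pow_right₀ (by linarith) hu

theorem eulerLog_le {n u : ℕ} (hn : 4 ≤ n) (hu : 2 ≤ u) :
    eulerLog u n ≤ 16 / 15 * (1 / (n : ℝ) ^ u) := by
  have h := neg_log_one_sub_le (x := 1 / (n : ℝ) ^ u) (by positivity)
    (one_div_natCast_pow_le hn hu) (by norm_num)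
  rwa [show (1 - 1 / 16 : ℝ)⁻¹ = 16 / 15 by norm_num] at h

theorem eulerLog_add_le {n u : ℕ} (hn : 1 < n) (hu : u ≠ 0) (k : ℕ) :
    eulerLog (u + k) n ≤ 1 / (n : ℝ) ^ k * eulerLog u n := by
  have h_split : 1 / (n : ℝ) ^ (u + k) = 1 / (n : ℝ) ^ k * (1 / (n : ℝ) ^ u) := by
    rw [pow_add]; field_simp
  rw [eulerLog, h_split]
  exact neg_log_one_sub_mul_le (one_div_natCast_pow_lt_one hn hu)
    (by positivity) (one_div_natCast_pow_le_one n k)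

theorem sum_one_div_add_pow_le {x : ℝ} (hx : 0 < x) {m : ℕ} (hm : m ≠ 0) (n : ℕ) :
    ∑ i ∈ Finset.range n, 1 / (x + i) ^ (m + 1) ≤ 1 / x ^ (m + 1) + 1 / m * (1 / x ^ m) := by
  have h_int (n : ℕ) : ∫ y in x..x + n, y ^ (-(m + 1) : ℤ) ≤ 1 / m * (1 / x ^ m) := by
    have h0 : (0 : ℝ) ∉ Set.uIcc x (x + n) :=
      Set.notMem_uIcc_of_lt hx (by positivity)
    rw [integral_zpow (.inr ⟨by omega, h0⟩)]
    have h_pos : 0 < ((x + n) ^ m)⁻¹ := by positivity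
    have h_exp : (-(m + 1) + 1 : ℤ) = -m := by ring
    rw [h_exp, zpow_neg, zpow_neg, zpow_natCast, zpow_natCast]
    push_cast
    rw [show (-(m + 1) + 1 : ℝ) = -m by ring, div_neg, ← neg_div, one_div_mul_eq_div]
    gcongr
    rw [one_div]
    linarith
  cases n with
  | zero => simp only [Finset.range_zero, Finset.sum_empty]; positivity
  | succ n =>
    have h_anti : AntitoneOn (fun y : ℝ => y ^ (-(m + 1) : ℤ)) (Set.Icc x (x + n)) := by
      intro y hy z _ hyz
      have hy0 : 0 < y := hx.trans_le hy.1
      change z ^ (-(m + 1 : ℕ) : ℤ) ≤ y ^ (-(m + 1 : ℕ) : ℤ)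
      rw [zpow_neg, zpow_neg, zpow_natCast, zpow_natCast]
      gcongr
    have h_sum := h_anti.sum_le_integral.trans (h_int n)
    rw [Finset.sum_range_succ', Nat.cast_zero, add_zero, add_comm]
    gcongr
    refine le_of_eq_of_le (Finset.sum_congr rfl fun i _ => ?_) h_sum
    rw [zpow_neg, one_div]
    norm_cast

theorem tsum_subtype_one_div_pow_le {P : ℝ} (hP : 1 ≤ P) {S : Set ℕ} (hS : ∀ n ∈ S, P ≤ n)
    {m : ℕ} (hm : m ≠ 0) :
    ∑' n : S, 1 / (n : ℝ) ^ (m + 1) ≤ 1 / P ^ (m + 1) * (1 + P / m) := by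
  have hP' : P ≤ (⌈P⌉₊ : ℝ) := Nat.le_ceil P
  have hn (n : S) : ⌈P⌉₊ ≤ (n : ℕ) := Nat.ceil_le.2 (hS n n.2)
  have hb := sum_one_div_add_pow_le (x := ⌈P⌉₊) (by linarith) hm
  have hs := summable_of_sum_range_le (fun n => by positivity) hb
  calc ∑' n : S, 1 / (n : ℝ) ^ (m + 1)
      ≤ ∑' i : ℕ, 1 / ((⌈P⌉₊ : ℝ) + i) ^ (m + 1) := by
        refine Summable.tsum_le_tsum_of_inj (fun n : S => (n : ℕ) - ⌈P⌉₊)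
          (fun n n' h => ?_) (fun _ _ => by positivity) (fun n => ?_)
          (summable_one_div_natCast_pow (by omega) S) hs
        · have := hn n
          have := hn n'
          exact Subtype.ext (by dsimp only at h; omega)
        · rw [Nat.cast_sub (hn n), add_sub_cancel]
    _ ≤ 1 / (⌈P⌉₊ : ℝ) ^ (m + 1) + 1 / m * (1 / (⌈P⌉₊ : ℝ) ^ m) :=
        Real.tsum_le_of_sum_range_le (fun n => by positivity) hb
    _ ≤ 1 / P ^ (m + 1) + 1 / m * (1 / P ^ m) := by gcongr
    _ = 1 / P ^ (m + 1) * (1 + P / m) := by rw [pow_succ]; field_simp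

/-- The logarithm of the Euler product `∏ (1 - n⁻ᵘ)⁻¹` over a set `S` of integers (for the
application, a set of primes). -/
noncomputable def logZeta (S : Set ℕ) (u : ℕ) : ℝ := ∑' n : S, eulerLog u n

theorem logZeta_nonneg (S : Set ℕ) (u : ℕ) : 0 ≤ logZeta S u :=
  tsum_nonneg fun n => eulerLog_nonneg u n

theorem logZeta_mono {S T : Set ℕ} (h : S ⊆ T) {u : ℕ} (hu : 2 ≤ u) :
    logZeta S u ≤ logZeta T u :=
  Summable.tsum_le_tsum_of_inj (Set.inclusion h) (Set.inclusion_injective h)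
    (fun n _ => eulerLog_nonneg u n) (fun _ => le_rfl) ((summable_eulerLog hu).subtype S)
    ((summable_eulerLog hu).subtype T)

theorem logZeta_biUnion {ι : Type*} {s : Finset ι} {S : ι → Set ℕ}
    (hS : (s : Set ι).PairwiseDisjoint S) {u : ℕ} (hu : 2 ≤ u) :
    logZeta (⋃ i ∈ s, S i) u = ∑ i ∈ s, logZeta (S i) u :=
  Summable.tsum_finset_bUnion_disjoint hS fun i _ => (summable_eulerLog hu).subtype (S i)

section

variable {P : ℝ} {S : Set ℕ} (hS : ∀ n ∈ S, P ≤ n)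
include hS

theorem logZeta_add_le (hP : 1 < P) {u : ℕ} (hu : 2 ≤ u) (k : ℕ) :
    logZeta S (u + k) ≤ 1 / P ^ k * logZeta S u := by
  have hsum {u : ℕ} (hu : 2 ≤ u) : Summable fun n : S => eulerLog u n :=
    (summable_eulerLog hu).subtype S
  rw [logZeta, logZeta, ← tsum_mul_left]
  refine (hsum (by omega)).tsum_le_tsum (fun n => ?_) ((hsum hu).mul_left _)
  have hPn := hS n n.2
  refine (eulerLog_add_le (by exact_mod_cast hP.trans_le hPn) (by omega) k).trans ?_
  have := eulerLog_nonneg u n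
  gcongr

theorem logZeta_le (hP : 4 ≤ P) {m : ℕ} (hm : m ≠ 0) :
    logZeta S (m + 1) ≤ 16 / 15 * (1 / P ^ (m + 1) * (1 + P / m)) := by
  have hm1 : 2 ≤ m + 1 := by omega
  calc logZeta S (m + 1) ≤ ∑' n : S, 16 / 15 * (1 / (n : ℝ) ^ (m + 1)) := by
        refine ((summable_eulerLog hm1).subtype S).tsum_le_tsum (fun n => eulerLog_le ?_ hm1)
          ((summable_one_div_natCast_pow hm1 S).mul_left _)
        exact_mod_cast hP.trans (hS n n.2)
    _ = 16 / 15 * ∑' n : S, 1 / (n : ℝ) ^ (m + 1) := tsum_mul_left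
    _ ≤ _ := by
        gcongr
        exact tsum_subtype_one_div_pow_le (by linarith) hS hm

end

/-! ### The Witt transform of a sequence -/

/-- The arithmetic function `w` with `∑_{d ∣ k} d w(d) = s(k)`, given by Möbius inversion; `wittExp`
is the case where `s` is a sequence of power sums. -/
noncomputable def wittTransform (s : ℕ → ℝ) (k : ℕ) : ℝ :=
  1 / (k : ℝ) * ∑ d ∈ k.divisors, (ArithmeticFunction.moebius (k / d) : ℝ) * s d

theorem sum_divisors_mul_wittTransform (s : ℕ → ℝ) {k : ℕ} (hk : 0 < k) :
    ∑ d ∈ k.divisors, (d : ℝ) * wittTransform s d = s k := by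
  refine ArithmeticFunction.sum_eq_iff_sum_mul_moebius_eq.2 (fun n hn => ?_) k hk
  have : (n : ℝ) ≠ 0 := by positivity
  rw [wittTransform, ← mul_assoc, mul_one_div_cancel this, one_mul,
    Nat.sum_divisorsAntidiagonal' fun i j => (ArithmeticFunction.moebius i : ℝ) * s j]

theorem sum_range_succ_pow_le {β : ℝ} (hβ : 2 ≤ β) (k : ℕ) :
    ∑ d ∈ Finset.range (k + 1), β ^ d ≤ 2 * β ^ k := by
  induction k with
  | zero => norm_num
  | succ k ih =>
    rw [Finset.sum_range_succ]
    have : 2 * β ^ k ≤ β * β ^ k := by gcongr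
    rw [pow_succ']
    linarith

theorem sum_divisors_pow_le {β : ℝ} (hβ : 2 ≤ β) (k : ℕ) :
    ∑ d ∈ k.divisors, β ^ d ≤ 2 * β ^ k := by
  refine (Finset.sum_le_sum_of_subset_of_nonneg (fun d hd => ?_) fun d _ _ => ?_).trans
    (sum_range_succ_pow_le hβ k)
  · exact Finset.mem_range_succ_iff.2 (Nat.divisor_le hd)
  · positivity

theorem hasSum_pow_div_neg_log_one_sub {y : ℝ} (hy : |y| < 1) :
    HasSum (fun m : ℕ+ => y ^ (m : ℕ) / (m : ℕ)) (-Real.log (1 - y)) := by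
  refine hasSum_pnat_iff_hasSum_succ (f := fun m : ℕ => y ^ m / m) |>.2 ?_
  simpa only [Nat.cast_add_one] using Real.hasSum_pow_div_log_of_abs_lt_one hy

theorem hasSum_sum_divisorsAntidiagonal {f : ℕ → ℕ → ℝ} {a : ℝ}
    (h : HasSum (fun p : ℕ+ × ℕ+ => f p.1 p.2) a) :
    HasSum (fun k : ℕ+ => ∑ c ∈ (k : ℕ).divisorsAntidiagonal, f c.1 c.2) a := by
  refine (sigmaAntidiagonalEquivProd.hasSum_iff.2 h).sigma fun k => ?_
  rw [← Finset.sum_coe_sort]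
  exact hasSum_fintype _

theorem sum_divisorsAntidiagonal_wittTransform (s : ℕ → ℝ) (x : ℝ) (k : ℕ+) :
    ∑ c ∈ (k : ℕ).divisorsAntidiagonal, wittTransform s c.1 * ((x ^ c.1) ^ c.2 / c.2) =
      s k * x ^ (k : ℕ) / (k : ℕ) := by
  have hterm (c : ℕ × ℕ) (hc : c ∈ (k : ℕ).divisorsAntidiagonal) :
      wittTransform s c.1 * ((x ^ c.1) ^ c.2 / c.2) =
        x ^ (k : ℕ) / (k : ℕ) * (c.1 * wittTransform s c.1) := by
    obtain ⟨hk, hk0⟩ := Nat.mem_divisorsAntidiagonal.1 hc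
    obtain ⟨h1, h2⟩ := mul_ne_zero_iff.1 (hk ▸ hk0)
    rw [← pow_mul, ← hk]
    push_cast
    field_simp
  rw [Finset.sum_congr rfl hterm, ← Finset.mul_sum,
    Nat.sum_divisorsAntidiagonal fun a _ => (a : ℝ) * wittTransform s a,
    sum_divisors_mul_wittTransform s k.pos]
  ring

section

variable {s : ℕ → ℝ} {C β : ℝ} (hC : 0 ≤ C) (hβ : 2 ≤ β) (hs : ∀ k, |s k| ≤ C * β ^ k)
include hC hβ hs

theorem abs_wittTransform_le (k : ℕ) : |wittTransform s k| ≤ 2 * C * β ^ k / k := by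
  have h_sum : |∑ d ∈ k.divisors, (ArithmeticFunction.moebius (k / d) : ℝ) * s d| ≤
      2 * C * β ^ k :=
    calc _ ≤ ∑ d ∈ k.divisors, C * β ^ d := by
          refine (Finset.abs_sum_le_sum_abs _ _).trans (Finset.sum_le_sum fun d _ => ?_)
          rw [abs_mul]
          refine (mul_le_of_le_one_left (abs_nonneg _) ?_).trans (hs d)
          exact_mod_cast ArithmeticFunction.abs_moebius_le_one
      _ = C * ∑ d ∈ k.divisors, β ^ d := by rw [Finset.mul_sum]
      _ ≤ C * (2 * β ^ k) := by gcongr; exact sum_divisors_pow_le hβ k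
      _ = 2 * C * β ^ k := by ring
  rw [wittTransform, abs_mul, abs_of_nonneg (by positivity), one_div_mul_eq_div]
  gcongr

/-- At `k = 2` this uses `w(2) = (s(2) - s(1)) / 2`; the general bound `2 C β ^ k / k` would only
give the constant `1`. -/
theorem abs_wittTransform_le_of_two_le {k : ℕ} (hk : 2 ≤ k) :
    |wittTransform s k| ≤ 3 / 4 * C * β ^ k := by
  obtain rfl | hk := hk.eq_or_lt
  · have h_two : wittTransform s 2 = 1 / 2 * (s 2 - s 1) := by
      rw [wittTransform, Nat.Prime.divisors Nat.prime_two, Finset.sum_pair (by norm_num),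
        Nat.div_one, Nat.div_self two_pos, ArithmeticFunction.moebius_apply_one,
        ArithmeticFunction.moebius_apply_prime Nat.prime_two]
      push_cast
      ring
    rw [h_two, abs_mul, abs_of_pos (by norm_num : (0 : ℝ) < 1 / 2)]
    have h_pow : C * β ^ 1 * 2 ≤ C * β ^ 2 := by
      rw [pow_one, pow_two, mul_assoc]
      gcongr
    linarith [abs_sub (s 2) (s 1), hs 1, hs 2]
  · refine (abs_wittTransform_le hC hβ hs k).trans ?_
    have hk' : (3 : ℝ) ≤ k := by exact_mod_cast hk
    rw [div_le_iff₀ (by linarith)]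
    have : 0 ≤ C * β ^ k := by positivity
    nlinarith

theorem summable_wittTransform_mul {x : ℝ} (hx : 0 ≤ x) (hβx : β * x ≤ 1 / 2) :
    Summable fun p : ℕ+ × ℕ+ =>
      wittTransform s p.1 * ((x ^ (p.1 : ℕ)) ^ (p.2 : ℕ) / (p.2 : ℕ)) := by
  have hx4 : x ≤ 1 / 4 := by nlinarith
  have hgeom {y : ℝ} (hy0 : 0 ≤ y) (hy1 : y < 1) : Summable fun j : ℕ+ => y ^ (j : ℕ) :=
    (summable_geometric_of_lt_one hy0 hy1).comp_injective PNat.coe_injective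
  have hg := ((hgeom (y := 1 / 2) (by norm_num) (by norm_num)).mul_left (2 * C)).mul_of_nonneg
    ((hgeom (y := 1 / 4) (by norm_num) (by norm_num)).mul_left 4)
    (fun j => by positivity) fun m => by positivity
  refine .of_norm_bounded hg fun ⟨j, m⟩ => ?_
  obtain ⟨n, hm⟩ : ∃ n, (m : ℕ) = n + 1 := Nat.exists_eq_succ_of_ne_zero m.ne_zero
  have hm1 : (1 : ℝ) ≤ (m : ℕ) := by exact_mod_cast m.2
  have hj1 : (1 : ℝ) ≤ (j : ℕ) := by exact_mod_cast j.2
  have hw : |wittTransform s j| ≤ 2 * C * β ^ (j : ℕ) :=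
    (abs_wittTransform_le hC hβ hs j).trans (div_le_self (by positivity) hj1)
  have hxj : x ^ (j : ℕ) ≤ 1 / 4 := (pow_le_of_le_one hx (by linarith) j.ne_zero).trans hx4
  have hβxj : β ^ (j : ℕ) * x ^ (j : ℕ) ≤ (1 / 2) ^ (j : ℕ) := by
    rw [← mul_pow]
    gcongr
  rw [Real.norm_eq_abs, abs_mul, abs_of_nonneg (by positivity : 0 ≤ (x ^ (j : ℕ)) ^ (m : ℕ) / _)]
  calc _ ≤ 2 * C * β ^ (j : ℕ) * (x ^ (j : ℕ)) ^ (m : ℕ) :=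
        mul_le_mul hw (div_le_self (by positivity) hm1) (by positivity) (by positivity)
    _ = 2 * C * (β ^ (j : ℕ) * x ^ (j : ℕ)) * (x ^ (j : ℕ)) ^ n := by rw [hm, pow_succ]; ring
    _ ≤ 2 * C * (1 / 2) ^ (j : ℕ) * (1 / 4) ^ n := by gcongr
    _ = 2 * C * (1 / 2) ^ (j : ℕ) * (4 * (1 / 4) ^ (m : ℕ)) := by rw [hm, pow_succ]; ring

theorem hasSum_wittTransform_mul_neg_log {x L : ℝ} (hx : 0 ≤ x) (hβx : β * x ≤ 1 / 2)
    (hL : HasSum (fun k : ℕ => s k * x ^ k / k) L) :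
    HasSum (fun j : ℕ => wittTransform s j * -Real.log (1 - x ^ j)) L := by
  have hx1 : x < 1 := by nlinarith
  have hrow (j : ℕ+) : HasSum (fun m : ℕ+ =>
      wittTransform s j * ((x ^ (j : ℕ)) ^ (m : ℕ) / (m : ℕ)))
      (wittTransform s j * -Real.log (1 - x ^ (j : ℕ))) := by
    refine (hasSum_pow_div_neg_log_one_sub ?_).mul_left _
    rw [abs_of_nonneg (by positivity)]
    exact pow_lt_one₀ hx hx1 j.ne_zero
  have hdouble := (summable_wittTransform_mul hC hβ hs hx hβx).hasSum
  have hcol := hasSum_sum_divisorsAntidiagonal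
    (f := fun j m => wittTransform s j * ((x ^ j) ^ m / m)) hdouble
  simp only [sum_divisorsAntidiagonal_wittTransform] at hcol
  have hrows := hdouble.prod_fiberwise hrow
  rw [hasSum_pnat_iff (f := fun k => s k * x ^ k / k), Nat.cast_zero, div_zero, add_zero] at hcol
  rw [hasSum_pnat_iff (f := fun j => wittTransform s j * -Real.log (1 - x ^ j)), pow_zero, sub_self,
    Real.log_zero, neg_zero, mul_zero, add_zero] at hrows
  exact hL.unique hcol ▸ hrows

end

/-! ### Polynomials as products of factors `1 - x ^ j` -/

section

open Polynomial

theorem hasSum_neg_log_norm_prod (S : Multiset ℂ) {x : ℝ} (hx : 0 ≤ x)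
    (hS : ∀ α ∈ S, ‖α‖ * x < 1) :
    HasSum (fun k : ℕ => (S.map fun α => α ^ k).sum.re * x ^ k / k)
      (-Real.log ‖(S.map fun α => 1 - α * (x : ℂ)).prod‖) := by
  have hnorm (α : ℂ) (hα : α ∈ S) : ‖α * (x : ℂ)‖ < 1 := by
    rw [norm_mul, Complex.norm_real, Real.norm_of_nonneg hx]
    exact hS α hα
  clear hS
  induction S using Multiset.induction with
  | empty => simp
  | cons a S ih =>
    have hne (α : ℂ) (hα : α ∈ a ::ₘ S) : 1 - α * (x : ℂ) ≠ 0 := by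
      intro h0
      have := hnorm α hα
      rw [← sub_eq_zero.1 h0, norm_one] at this
      exact this.false
    have hprod : (S.map fun α => 1 - α * (x : ℂ)).prod ≠ 0 := by
      simp only [Ne, Multiset.prod_eq_zero_iff, Multiset.mem_map, not_exists, not_and]
      exact fun α hα => hne α (Multiset.mem_cons_of_mem hα)
    have ha := Complex.hasSum_re
      (Complex.hasSum_taylorSeries_neg_log (hnorm a (Multiset.mem_cons_self a S)))
    convert ha.add (ih fun α hα => hnorm α (Multiset.mem_cons_of_mem hα)) using 1
    · funext k
      rw [Multiset.map_cons, Multiset.sum_cons, Complex.add_re, add_mul, add_div, mul_pow,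
        ← Complex.ofReal_pow, ← Complex.ofReal_natCast, Complex.div_ofReal_re,
        Complex.re_mul_ofReal]
    · rw [Multiset.map_cons, Multiset.prod_cons, norm_mul, Real.log_mul
        (norm_ne_zero_iff.2 (hne a (Multiset.mem_cons_self a S))) (norm_ne_zero_iff.2 hprod),
        Complex.neg_re, Complex.log_re, neg_add]

section

variable {F : ℝ[X]} (hF0 : F.eval 0 = 1)
include hF0

theorem aeval_zero_eq_one : aeval (0 : ℂ) F = 1 := by
  rw [← map_zero (algebraMap ℝ ℂ), aeval_algebraMap_apply_eq_algebraMap_eval, hF0, map_one]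

theorem ne_zero_of_mem_aroots {ρ : ℂ} (hρ : ρ ∈ F.aroots ℂ) : ρ ≠ 0 := by
  rintro rfl
  exact zero_ne_one ((mem_aroots.1 hρ).2.symm.trans (aeval_zero_eq_one hF0))

theorem aeval_eq_prod_one_sub_inv_mul (z : ℂ) :
    aeval z F = ((F.aroots ℂ).map fun ρ => 1 - ρ⁻¹ * z).prod := by
  have hsplit := IsAlgClosed.splits (F.map (algebraMap ℝ ℂ))
  have hfactor : ((F.aroots ℂ).map fun ρ => z - ρ).prod =
      ((F.aroots ℂ).map fun ρ => 0 - ρ).prod * ((F.aroots ℂ).map fun ρ => 1 - ρ⁻¹ * z).prod := by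
    rw [← Multiset.prod_map_mul]
    refine congrArg Multiset.prod (Multiset.map_congr rfl fun ρ hρ => ?_)
    have := ne_zero_of_mem_aroots hF0 hρ
    field_simp
    ring
  rw [hsplit.aeval_eq_prod_aroots, hfactor, ← mul_assoc, ← hsplit.aeval_eq_prod_aroots,
    aeval_zero_eq_one hF0, one_mul]

theorem powerSum_one : powerSum F 1 = -F.coeff 1 := by
  have hsplit := IsAlgClosed.splits (F.map (algebraMap ℝ ℂ))
  have h0 : (F.map (algebraMap ℝ ℂ)).eval 0 = 1 := by
    rw [eval_map_algebraMap, aeval_zero_eq_one hF0]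
  have hlogDeriv : ((F.coeff 1 : ℝ) : ℂ) = ((F.aroots ℂ).map fun ρ => 1 / (0 - ρ)).sum := by
    have h := hsplit.eval_derivative_div_eval_of_ne_zero (h0 ▸ one_ne_zero)
    rw [h0, div_one, ← coeff_zero_eq_eval_zero, coeff_derivative, coeff_map, Nat.cast_zero,
      zero_add, zero_add, mul_one] at h
    exact h
  have hsum : ((F.aroots ℂ).map fun ρ => ρ⁻¹ ^ 1).sum = -((F.coeff 1 : ℝ) : ℂ) := by
    rw [hlogDeriv, ← Multiset.sum_map_neg', Multiset.map_map]
    refine congrArg Multiset.sum (Multiset.map_congr rfl fun ρ _ => ?_)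
    rw [Function.comp_apply, pow_one, zero_sub, one_div, inv_neg, neg_neg]
  rw [powerSum, hsum, Complex.neg_re, Complex.ofReal_re]

end

section

variable {F : ℝ[X]} {β : ℝ} (hβF : ∀ ρ ∈ F.aroots ℂ, ‖ρ⁻¹‖ ≤ β)
include hβF

theorem abs_powerSum_le (k : ℕ) : |powerSum F k| ≤ F.natDegree * β ^ k := by
  rw [powerSum, ← IsAlgClosed.card_aroots_eq_natDegree (B := ℂ) (p := F)]
  refine (Complex.abs_re_le_norm _).trans ((norm_multiset_sum_le _).trans ?_)
  rw [Multiset.map_map, ← nsmul_eq_mul]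
  refine (Multiset.sum_le_card_nsmul _ (β ^ k) fun y hy => ?_).trans_eq (by rw [Multiset.card_map])
  obtain ⟨ρ, hρ, rfl⟩ := Multiset.mem_map.1 hy
  rw [Function.comp_apply, norm_pow]
  exact pow_le_pow_left₀ (norm_nonneg _) (hβF ρ hρ) k

variable (hF0 : F.eval 0 = 1) {x : ℝ} (hx : 0 ≤ x) (hβx : β * x < 1)
include hF0 hx hβx

theorem eval_pos : 0 < F.eval x := by
  by_contra! hneg
  obtain ⟨c, ⟨hc, hcx⟩, hc0 : F.eval c = 0⟩ := intermediate_value_Icc' hx F.continuous.continuousOn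
    (show (0 : ℝ) ∈ Set.Icc (F.eval x) (F.eval 0) from ⟨hneg, hF0 ▸ zero_le_one⟩)
  have hF : F ≠ 0 := by
    rintro rfl
    exact zero_ne_one (eval_zero.symm.trans hF0)
  have hroot : (c : ℂ) ∈ F.aroots ℂ := by
    rw [mem_aroots, ← Complex.coe_algebraMap, aeval_algebraMap_apply_eq_algebraMap_eval, hc0]
    exact ⟨hF, map_zero _⟩
  have hcpos : 0 < c := hc.lt_of_ne fun h => ne_zero_of_mem_aroots hF0 hroot (by simp [← h])
  have hβc := hβF _ hroot
  rw [norm_inv, Complex.norm_real, Real.norm_of_nonneg hc, inv_le_iff_one_le_mul₀ hcpos] at hβc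
  nlinarith

theorem hasSum_powerSum :
    HasSum (fun k : ℕ => powerSum F k * x ^ k / k) (-Real.log (F.eval x)) := by
  have h := hasSum_neg_log_norm_prod ((F.aroots ℂ).map fun ρ => ρ⁻¹) hx fun α hα => by
    obtain ⟨ρ, hρ, rfl⟩ := Multiset.mem_map.1 hα
    exact (mul_le_mul_of_nonneg_right (hβF ρ hρ) hx).trans_lt hβx
  simp only [Multiset.map_map, Function.comp_def] at h
  rwa [← aeval_eq_prod_one_sub_inv_mul hF0, ← Complex.coe_algebraMap,
    aeval_algebraMap_apply_eq_algebraMap_eval, Complex.coe_algebraMap, Complex.norm_real,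
    Real.norm_eq_abs, Real.log_abs] at h

end

theorem wittExp_sub_wittExp (F G : ℝ[X]) (k : ℕ) :
    wittExp G k - wittExp F k = wittTransform (fun k => powerSum G k - powerSum F k) k := by
  simp only [wittExp, wittTransform, mul_sub, Finset.sum_sub_distrib]

theorem wittExp_zero (F : ℝ[X]) : wittExp F 0 = 0 := by
  rw [wittExp, Nat.divisors_zero, Finset.sum_empty, mul_zero]

theorem wittExp_one (F : ℝ[X]) : wittExp F 1 = powerSum F 1 := by
  rw [wittExp, Nat.divisors_one, Finset.sum_singleton, Nat.div_one,
    ArithmeticFunction.moebius_apply_one, Nat.cast_one, Int.cast_one, div_one, one_mul, one_mul]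

section

variable {F G : ℝ[X]}

theorem wittExp_one_eq (hF0 : F.eval 0 = 1) (hG0 : G.eval 0 = 1) (hX : X ^ 2 ∣ F - G) :
    wittExp G 1 = wittExp F 1 := by
  have h := X_pow_dvd_iff.1 hX 1 one_lt_two
  rw [coeff_sub, sub_eq_zero] at h
  rw [wittExp_one, wittExp_one, powerSum_one hF0, powerSum_one hG0, h]

variable {β : ℝ} (hβF : ∀ ρ ∈ F.aroots ℂ, ‖ρ⁻¹‖ ≤ β) (hβG : ∀ ρ ∈ G.aroots ℂ, ‖ρ⁻¹‖ ≤ β)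
include hβF hβG

theorem abs_powerSum_sub_le (hβ : 0 ≤ β) (k : ℕ) : |powerSum G k - powerSum F k| ≤
    2 * (max F.natDegree G.natDegree : ℝ) * β ^ k :=
  calc |powerSum G k - powerSum F k|
      ≤ G.natDegree * β ^ k + F.natDegree * β ^ k :=
        (abs_sub _ _).trans (add_le_add (abs_powerSum_le hβG k) (abs_powerSum_le hβF k))
    _ ≤ (max F.natDegree G.natDegree : ℝ) * β ^ k + (max F.natDegree G.natDegree : ℝ) * β ^ k := by
        gcongr
        exacts [le_max_right _ _, le_max_left _ _]
    _ = 2 * (max F.natDegree G.natDegree : ℝ) * β ^ k := by ring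

variable (hβ : 2 ≤ β)
include hβ

theorem abs_wittExp_sub_le (k : ℕ) : |wittExp G k - wittExp F k| ≤
    4 * (max F.natDegree G.natDegree : ℝ) * β ^ k / k := by
  rw [wittExp_sub_wittExp]
  refine (abs_wittTransform_le (by positivity) hβ
    (abs_powerSum_sub_le hβF hβG (by linarith)) k).trans_eq ?_
  ring

theorem abs_wittExp_sub_le_of_two_le {k : ℕ} (hk : 2 ≤ k) : |wittExp G k - wittExp F k| ≤
    3 / 2 * (max F.natDegree G.natDegree : ℝ) * β ^ k := by
  rw [wittExp_sub_wittExp]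
  refine (abs_wittTransform_le_of_two_le (by positivity) hβ
    (abs_powerSum_sub_le hβF hβG (by linarith)) hk).trans_eq ?_
  ring

theorem hasSum_wittExp_sub (hF0 : F.eval 0 = 1) (hG0 : G.eval 0 = 1) {x : ℝ} (hx : 0 ≤ x)
    (hβx : β * x ≤ 1 / 2) :
    HasSum (fun j : ℕ => (wittExp G j - wittExp F j) * -Real.log (1 - x ^ j))
      (Real.log (F.eval x / G.eval x)) := by
  have hβx' : β * x < 1 := by linarith
  simp only [wittExp_sub_wittExp]
  refine hasSum_wittTransform_mul_neg_log (C := 2 * (max F.natDegree G.natDegree : ℝ))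
    (by positivity) hβ (abs_powerSum_sub_le hβF hβG (by linarith)) hx hβx ?_
  have h := (hasSum_powerSum hβG hG0 hx hβx').sub (hasSum_powerSum hβF hF0 hx hβx')
  rw [neg_sub_neg, ← Real.log_div (eval_pos hβF hF0 hx hβx').ne'
    (eval_pos hβG hG0 hx hβx').ne'] at h
  simpa only [sub_mul, sub_div] using h

end

end

/-! ### The matrices `N_d` -/

theorem sum_moebius_mul_gcd_eq_zero {b c : ℕ} (hb : b ≠ 0) (hc : c ∣ b) (hcb : c ≠ b)
    (φ : ℕ → ℝ) :
    ∑ k ∈ b.divisors, (ArithmeticFunction.moebius (b / k) : ℝ) * φ (c.gcd k) = 0 := by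
  have hc0 : c ≠ 0 := ne_zero_of_dvd_ne_zero hb hc
  set ψ : ℕ → ℝ := fun d => ∑ x ∈ d.divisorsAntidiagonal,
    (ArithmeticFunction.moebius x.1 : ℝ) * φ x.2
  have hψ : ∀ n > 0, ∑ i ∈ n.divisors, ψ i = φ n :=
    ArithmeticFunction.sum_eq_iff_sum_mul_moebius_eq.2 fun n _ => rfl
  have hψ_gcd (n : ℕ) (hn : n > 0) :
      ∑ i ∈ n.divisors, (if i ∣ c then ψ i else 0) = φ (c.gcd n) := by
    rw [← hψ _ (Nat.gcd_pos_of_pos_right _ hn), ← Finset.sum_filter]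
    congr 1
    ext i
    rw [Finset.mem_filter, Nat.mem_divisors, Nat.mem_divisors, Nat.dvd_gcd_iff]
    have h_gcd := Nat.gcd_ne_zero_left (n := n) hc0
    exact ⟨fun h => ⟨⟨h.2, h.1.1⟩, h_gcd⟩, fun h => ⟨⟨h.1.2, hn.ne'⟩, h.1.1⟩⟩
  have h_inv := ArithmeticFunction.sum_eq_iff_sum_mul_moebius_eq.1 hψ_gcd b
    (Nat.pos_of_ne_zero hb)
  rw [if_neg fun h => hcb (Nat.dvd_antisymm hc h)] at h_inv
  rw [← h_inv, Nat.sum_divisorsAntidiagonal' fun i j =>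
    (ArithmeticFunction.moebius i : ℝ) * φ (c.gcd j)]

section

theorem card_mul_relIndex_of_le {H : Type*} [Group H] {K B : Subgroup H} (h : K ≤ B) :
    Nat.card K * K.relIndex B = Nat.card B := by
  simpa only [Subgroup.relIndex_bot_left] using Subgroup.relIndex_mul_relIndex ⊥ K B bot_le h

variable {H : Type*} [CommGroup H] [Finite H]

theorem card_ker_powMonoidHom_inf (B : Subgroup H) [IsCyclic B] (k : ℕ) :
    Nat.card ↥((powMonoidHom k : H →* H).ker ⊓ B) = (Nat.card B).gcd k := by
  have h_ker : (powMonoidHom k : H →* H).ker.subgroupOf B = (powMonoidHom k : B →* B).ker := by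
    ext x
    rw [Subgroup.mem_subgroupOf, MonoidHom.mem_ker, MonoidHom.mem_ker, Subtype.ext_iff]
    rfl
  rw [← IsCyclic.card_powMonoidHom_ker, ← h_ker, ← Subgroup.inf_subgroupOf_right]
  exact Nat.card_congr (Subgroup.subgroupOfEquivOfLe inf_le_right).symm.toEquiv

theorem eq_ker_powMonoidHom_inf {K B : Subgroup H} [IsCyclic B] (h : K ≤ B) :
    K = (powMonoidHom (Nat.card K) : H →* H).ker ⊓ B := by
  refine Subgroup.eq_of_le_of_card_ge (le_inf (fun x hx => ?_) h) ?_
  · exact congrArg Subtype.val (pow_card_eq_one' (x := (⟨x, hx⟩ : K)))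
  · rw [card_ker_powMonoidHom_inf, Nat.gcd_eq_right (Subgroup.card_dvd_of_le h)]

theorem bijOn_card_subgroups_le (B : Subgroup H) [IsCyclic B] :
    Set.BijOn (fun K : Subgroup H => Nat.card K) {K | K ≤ B} (Nat.card B).divisors := by
  refine ⟨fun K hK => ?_, fun K hK K' hK' h => ?_, fun k hk => ?_⟩
  · exact Nat.mem_divisors.2 ⟨Subgroup.card_dvd_of_le hK, Nat.card_pos.ne'⟩
  · rw [eq_ker_powMonoidHom_inf hK, eq_ker_powMonoidHom_inf hK']
    exact congrArg (fun k => (powMonoidHom k : H →* H).ker ⊓ B) h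
  · refine ⟨(powMonoidHom k : H →* H).ker ⊓ B, Set.mem_ofPred.2 inf_le_right, ?_⟩
    exact (card_ker_powMonoidHom_inf B k).trans (Nat.gcd_eq_right (Nat.dvd_of_mem_divisors hk))

theorem gcd_card_inf_mul_relIndex {K B : Subgroup H} [IsCyclic B] (hK : K ≤ B) (B' : Subgroup H) :
    (Nat.card ↥(B ⊓ B')).gcd (Nat.card K) * K.relIndex B' = Nat.card B' := by
  have : IsCyclic ↥(B ⊓ B') := Subgroup.isCyclic_of_le inf_le_left
  rw [← Subgroup.inf_relIndex_right, ← card_ker_powMonoidHom_inf, ← inf_assoc,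
    ← eq_ker_powMonoidHom_inf hK, card_mul_relIndex_of_le inf_le_right]

omit [Finite H] in
theorem relIndex_dvd_exponent (K B : Subgroup H) [IsCyclic B] :
    K.relIndex B ∣ Monoid.exponent H := by
  refine (Subgroup.relIndex_dvd_card K B).trans ?_
  rw [← IsCyclic.exponent_eq_card]
  exact Monoid.exponent_dvd_of_monoidHom B.subtype B.subtype_injective

end

instance {q : ℕ} (B : CyclicSubgroup q) : IsCyclic B.1 := B.2

variable {q : ℕ}

theorem relIndex_mem_divisors_expG (K : Subgroup (G q)) (B : CyclicSubgroup q) :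
    K.relIndex B.1 ∈ (expG q).divisors :=
  Nat.mem_divisors.2 ⟨relIndex_dvd_exponent K B.1, Monoid.exponent_ne_zero_of_finite⟩

theorem N_apply_eq_sum_divisors (d : ℕ) (B₀ B₁ : CyclicSubgroup q) :
    N q d B₀ B₁ = ∑ k ∈ (Nat.card B₀.1).divisors,
      (ArithmeticFunction.moebius (Nat.card B₀.1 / k) : ℝ) *
        if (Nat.card ↥(B₀.1 ⊓ B₁.1)).gcd k * d = Nat.card B₁.1 then 1 else 0 := by
  have h_iff (K : Subgroup (G q)) (hK : K ≤ B₀.1) : K.relIndex (K ⊔ B₁.1) = d ↔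
      (Nat.card ↥(B₀.1 ⊓ B₁.1)).gcd (Nat.card K) * d = Nat.card B₁.1 := by
    rw [Subgroup.relIndex_sup_left, ← gcd_card_inf_mul_relIndex hK B₁.1, mul_right_inj', eq_comm]
    exact Nat.gcd_ne_zero_right Nat.card_pos.ne'
  have h_bij := bijOn_card_subgroups_le B₀.1
  simp only [mul_ite, mul_one, mul_zero]
  rw [← Finset.sum_filter, ← finsum_mem_coe_finset, N]
  refine finsum_mem_eq_of_bijOn (fun K => Nat.card K) ⟨?_, ?_, ?_⟩ ?_
  · exact fun K hK => Finset.mem_coe.2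
      (Finset.mem_filter.2 ⟨h_bij.mapsTo hK.1, (h_iff K hK.1).1 hK.2⟩)
  · exact h_bij.injOn.mono fun K hK => hK.1
  · intro k hk
    obtain ⟨hk_dvd, hk_eq⟩ := Finset.mem_filter.1 (Finset.mem_coe.1 hk)
    obtain ⟨K, hK, rfl⟩ := h_bij.surjOn hk_dvd
    exact ⟨K, ⟨hK, (h_iff K hK).2 hk_eq⟩, rfl⟩
  · rintro K ⟨hK, -⟩
    rw [← card_mul_relIndex_of_le hK, Nat.mul_div_cancel_left _ Nat.card_pos]

theorem N_apply_eq_zero (d : ℕ) {B₀ B₁ : CyclicSubgroup q} (h : ¬ B₀.1 ≤ B₁.1) :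
    N q d B₀ B₁ = 0 := by
  rw [N_apply_eq_sum_divisors]
  refine sum_moebius_mul_gcd_eq_zero Nat.card_pos.ne' (Subgroup.card_dvd_of_le inf_le_left)
    (fun hc => h ?_) fun m => if m * d = Nat.card B₁.1 then 1 else 0
  exact inf_eq_left.1 (Subgroup.eq_of_le_of_card_ge inf_le_left hc.ge)

theorem N_apply_of_le (d : ℕ) {B₀ B₁ : CyclicSubgroup q} (h : B₀.1 ≤ B₁.1) :
    N q d B₀ B₁ = ∑ k ∈ (Nat.card B₀.1).divisors with k * d = Nat.card B₁.1,
      (ArithmeticFunction.moebius (Nat.card B₀.1 / k) : ℝ) := by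
  rw [N_apply_eq_sum_divisors, inf_eq_left.2 h, Finset.sum_filter]
  refine Finset.sum_congr rfl fun k hk => ?_
  rw [Nat.gcd_eq_right (Nat.dvd_of_mem_divisors hk), mul_ite, mul_one, mul_zero]

theorem abs_N_apply_le_one (d : ℕ) (B₀ B₁ : CyclicSubgroup q) : |N q d B₀ B₁| ≤ 1 := by
  by_cases h : B₀.1 ≤ B₁.1
  · set S := (Nat.card B₀.1).divisors.filter fun k => k * d = Nat.card B₁.1
    have hS_card : S.card ≤ 1 := Finset.card_le_one.2 fun k hk k' hk' => by
      have hk := (Finset.mem_filter.1 hk).2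
      have hk' := (Finset.mem_filter.1 hk').2
      have hd : 0 < d := Nat.pos_of_mul_pos_left (hk ▸ Nat.card_pos)
      exact Nat.eq_of_mul_eq_mul_right hd (hk.trans hk'.symm)
    calc |N q d B₀ B₁|
        ≤ ∑ k ∈ S, |(ArithmeticFunction.moebius (Nat.card B₀.1 / k) : ℝ)| := by
          rw [N_apply_of_le d h]
          exact Finset.abs_sum_le_sum_abs _ _
      _ ≤ S.card • (1 : ℝ) := Finset.sum_le_card_nsmul _ _ _ fun k _ => by
          exact_mod_cast ArithmeticFunction.abs_moebius_le_one
      _ ≤ 1 := by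
          rw [nsmul_eq_mul, mul_one]
          exact_mod_cast hS_card
  · rw [N_apply_eq_zero d h, abs_zero]
    exact zero_le_one

theorem N_one_apply_self (B : CyclicSubgroup q) : N q 1 B B = 1 := by
  rw [N_apply_of_le 1 le_rfl]
  simp only [mul_one]
  rw [Finset.filter_eq', if_pos (Nat.mem_divisors_self _ Nat.card_pos.ne'),
    Finset.sum_singleton, Nat.div_self Nat.card_pos, ArithmeticFunction.moebius_apply_one,
    Int.cast_one]

theorem N_one_apply_of_ne {B₀ B₁ : CyclicSubgroup q} (hB : B₀ ≠ B₁) : N q 1 B₀ B₁ = 0 := by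
  by_cases h : B₀.1 ≤ B₁.1
  · rw [N_apply_of_le 1 h]
    refine Finset.sum_eq_zero fun k hk => absurd ?_ hB
    obtain ⟨hk_dvd, hk_eq⟩ := Finset.mem_filter.1 hk
    rw [mul_one] at hk_eq
    exact Subtype.ext (Subgroup.eq_of_le_of_card_ge h
      (hk_eq ▸ Nat.divisor_le hk_dvd))
  · exact N_apply_eq_zero 1 h

theorem N_one [DecidableEq (CyclicSubgroup q)] : N q 1 = 1 := by
  ext B₀ B₁
  by_cases hB : B₀ = B₁
  · rw [hB, N_one_apply_self, Matrix.one_apply_eq]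
  · rw [N_one_apply_of_ne hB, Matrix.one_apply_ne hB]

open Classical in
theorem N_apply_eq_sum_cyclicSubgroup [NeZero q] (d : ℕ) (B₀ B₁ : CyclicSubgroup q) :
    N q d B₀ B₁ = ∑ K : CyclicSubgroup q with K.1 ≤ B₀.1 ∧ K.1.relIndex B₁.1 = d,
      (ArithmeticFunction.moebius (K.1.relIndex B₀.1) : ℝ) := by
  rw [← finsum_mem_coe_finset, N]
  simp only [Subgroup.relIndex_sup_left]
  symm
  refine finsum_mem_eq_of_bijOn Subtype.val ⟨fun K hK => ?_, Subtype.val_injective.injOn, ?_⟩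
    fun K _ => rfl
  · exact (Finset.mem_filter.1 hK).2
  · rintro K ⟨hK, hd⟩
    have hK_cyclic : IsCyclic K := Subgroup.isCyclic_of_le hK
    exact ⟨⟨K, hK_cyclic⟩, Finset.mem_coe.2 (Finset.mem_filter.2 ⟨Finset.mem_univ _, hK, hd⟩), rfl⟩

/-! ### Characters and Euler products -/

section

open Complex

theorem hasSum_ite_dvd_pow_div {f : ℕ} (hf : f ≠ 0) {z : ℂ} (hz : ‖z‖ < 1) :
    HasSum (fun n : ℕ => if f ∣ n then z ^ n / n else 0) (-log (1 - z ^ f) / f) := by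
  have h_inj : Function.Injective fun n : ℕ => f * n := mul_right_injective₀ hf
  have hzf : ‖z ^ f‖ < 1 := by
    rw [norm_pow]
    exact pow_lt_one₀ (norm_nonneg z) hz hf
  rw [← h_inj.hasSum_iff fun n hn => if_neg fun ⟨m, hm⟩ => hn ⟨m, hm.symm⟩]
  refine ((hasSum_taylorSeries_neg_log hzf).div_const (f : ℂ)).congr_fun fun n => ?_
  rw [Function.comp_apply, if_pos (dvd_mul_right f n), pow_mul, Nat.cast_mul, div_div, mul_comm]

end

theorem pow_mem_iff_relIndex_dvd {H : Type*} [CommGroup H] (K : Subgroup H) (g : H) (n : ℕ) :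
    g ^ n ∈ K ↔ K.relIndex (Subgroup.zpowers g) ∣ n := by
  have h_order : K.relIndex (Subgroup.zpowers g) = orderOf (g : H ⧸ K) := by
    conv_lhs => rw [← QuotientGroup.ker_mk' K]
    rw [Subgroup.relIndex_ker, MonoidHom.map_zpowers, Nat.card_zpowers]
    rfl
  rw [h_order, orderOf_dvd_iff_pow_eq_one, ← QuotientGroup.mk_pow, QuotientGroup.eq_one_iff]

section

variable {q : ℕ} [NeZero q]

theorem mem_perp {K : Subgroup (G q)} {χ : DirichletCharacter ℂ q} :
    χ ∈ perp K ↔ ∀ g ∈ K, χ (g : ZMod q) = 1 := by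
  simp only [perp, Finset.mem_filter, Finset.mem_univ, true_and]

theorem mem_perp_iff_mem_subgroupOrderIso {K : Subgroup (G q)} {χ : DirichletCharacter ℂ q} :
    χ ∈ perp K ↔ χ ∈ OrderDual.ofDual (MulChar.subgroupOrderIsoSubgroupMulChar (ZMod q) ℂ K) :=
  mem_perp.trans MulChar.mem_subgroupOrderIsoSubgroupMulChar_iff.symm

theorem card_perp (K : Subgroup (G q)) : (perp K).card = K.index := by
  rw [Subgroup.index, ← MulChar.card_subgroupOrderIsoSubgroupMulChar (M := ZMod q) (R := ℂ),
    ← Nat.card_eq_finsetCard]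
  exact Nat.card_congr (Equiv.subtypeEquivRight fun χ => mem_perp_iff_mem_subgroupOrderIso)

theorem exists_mem_perp_apply_ne_one {K : Subgroup (G q)} {g : G q} (hg : g ∉ K) :
    ∃ χ ∈ perp K, χ (g : ZMod q) ≠ 1 := by
  by_contra! h
  refine hg ?_
  rw [← (MulChar.subgroupOrderIsoSubgroupMulChar (ZMod q) ℂ).symm_apply_apply K]
  exact MulChar.mem_subgroupOrderIsoSubgroupMulChar_symm_iff.2 fun χ hχ =>
    h χ (mem_perp_iff_mem_subgroupOrderIso.2 hχ)

theorem mul_mem_perp_iff {K : Subgroup (G q)} {χ ψ : DirichletCharacter ℂ q} (hχ : χ ∈ perp K) :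
    χ * ψ ∈ perp K ↔ ψ ∈ perp K := by
  simp only [mem_perp_iff_mem_subgroupOrderIso] at hχ ⊢
  exact Subgroup.mul_mem_cancel_left _ hχ

open Classical in
theorem sum_perp_apply (K : Subgroup (G q)) (g : G q) :
    ∑ χ ∈ perp K, χ (g : ZMod q) = if g ∈ K then (K.index : ℂ) else 0 := by
  split_ifs with hg
  · rw [Finset.sum_congr rfl fun χ hχ => mem_perp.1 hχ g hg, Finset.sum_const, card_perp,
      nsmul_one]
  · obtain ⟨χ, hχ, hχg⟩ := exists_mem_perp_apply_ne_one hg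
    refine eq_zero_of_mul_eq_self_left hχg ?_
    rw [Finset.mul_sum]
    exact Finset.sum_equiv (Equiv.mulLeft χ) (fun ψ => (mul_mem_perp_iff hχ).symm) fun ψ _ => rfl

theorem sum_perp_neg_log (K : Subgroup (G q)) (g : G q) {x : ℝ} (h0 : 0 ≤ x) (h1 : x < 1) :
    ∑ χ ∈ perp K, -Complex.log (1 - χ (g : ZMod q) * x) =
      ((K.index / K.relIndex (Subgroup.zpowers g) *
        -Real.log (1 - x ^ K.relIndex (Subgroup.zpowers g)) : ℝ) : ℂ) := by
  classical
  set f := K.relIndex (Subgroup.zpowers g)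
  have hf : f ≠ 0 := Subgroup.index_ne_zero_of_finite
  have hx : ‖(x : ℂ)‖ < 1 := by rwa [Complex.norm_real, Real.norm_of_nonneg h0]
  have h_norm (χ : DirichletCharacter ℂ q) : ‖χ (g : ZMod q) * x‖ < 1 := by
    rwa [norm_mul, DirichletCharacter.unit_norm_eq_one, one_mul]
  have h_coeff (n : ℕ) : ∑ χ ∈ perp K, (χ (g : ZMod q) * x) ^ n / n =
      K.index * if f ∣ n then (x : ℂ) ^ n / n else 0 := by
    have h_pow := sum_perp_apply K (g ^ n)
    simp only [pow_mem_iff_relIndex_dvd, Units.val_pow_eq_pow_val, map_pow] at h_pow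
    simp only [mul_pow, mul_div_assoc, ← Finset.sum_mul]
    rw [h_pow, ite_mul, mul_ite, zero_mul, mul_zero]
  have h_left := hasSum_sum (s := perp K) fun χ _ =>
    Complex.hasSum_taylorSeries_neg_log (h_norm χ)
  simp only [h_coeff] at h_left
  rw [h_left.unique ((hasSum_ite_dvd_pow_div hf hx).mul_left _), Complex.ofReal_mul,
    Complex.ofReal_neg, Complex.ofReal_log (sub_nonneg.2 (pow_le_one₀ h0 h1.le))]
  push_cast
  ring

end

/-- The logarithm of the Euler factor `(1 - χ(n) n⁻ᵘ)⁻¹`, the twist of `eulerLog` by `χ`. -/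
noncomputable def twistedEulerLog {q : ℕ} (χ : DirichletCharacter ℂ q) (u n : ℕ) : ℂ :=
  -Complex.log (1 - χ (n : ZMod q) * ((1 / (n : ℝ) ^ u : ℝ) : ℂ))

/-- The set of primes `p ≥ P`, the index set of the Euler product `LP P`. -/
def largePrimes (P : ℝ) : Set ℕ := {p | p.Prime ∧ P ≤ p}

/-- The set of primes `p ≥ P` whose residue class modulo `q` generates `B`. -/
def classPrimes {q : ℕ} (P : ℝ) (B : CyclicSubgroup q) : Set ℕ :=
  {p | p.Prime ∧ P ≤ p ∧ ∃ a ∈ generators B.1, (a : ZMod q) = p}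

section

variable {q : ℕ}

theorem LatticeClass.generators_span (A : LatticeClass q) : generators A.span.1 = A.1 := by
  obtain ⟨A, K, hK, rfl⟩ := A
  exact congrArg generators (closure_generators K hK)

theorem norm_apply_mul_one_div_pow_le (χ : DirichletCharacter ℂ q) (u n : ℕ) :
    ‖χ (n : ZMod q) * ((1 / (n : ℝ) ^ u : ℝ) : ℂ)‖ ≤ 1 / (n : ℝ) ^ u := by
  rw [norm_mul, Complex.norm_real, Real.norm_of_nonneg (by positivity)]
  exact mul_le_of_le_one_left (by positivity) (χ.norm_le_one _)

theorem exp_twistedEulerLog (χ : DirichletCharacter ℂ q) {u n : ℕ} (hn : 1 < n) (hu : u ≠ 0) :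
    Complex.exp (twistedEulerLog χ u n) = (1 - χ (n : ZMod q) / (n : ℂ) ^ u)⁻¹ := by
  have h_norm := (norm_apply_mul_one_div_pow_le χ u n).trans_lt (one_div_natCast_pow_lt_one hn hu)
  have h_ne : 1 - χ (n : ZMod q) * ((1 / (n : ℝ) ^ u : ℝ) : ℂ) ≠ 0 := by
    intro h
    rw [← sub_eq_zero.1 h, norm_one] at h_norm
    exact h_norm.false
  rw [twistedEulerLog, Complex.exp_neg, Complex.exp_log h_ne]
  push_cast
  rw [mul_one_div]

theorem summable_twistedEulerLog (χ : DirichletCharacter ℂ q) {u : ℕ} (hu : 2 ≤ u) :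
    Summable (twistedEulerLog χ u) := by
  have h := Complex.summable_log_one_add_of_summable (Summable.of_norm_bounded
    (Real.summable_one_div_nat_pow.2 hu) (norm_apply_mul_one_div_pow_le χ u)).neg
  exact h.neg.congr fun n => by rw [twistedEulerLog, sub_eq_add_neg]

theorem LP_natCast_eq_exp (P : ℝ) (χ : DirichletCharacter ℂ q) {u : ℕ} (hu : 2 ≤ u) :
    LP P u χ = Complex.exp (∑' p : largePrimes P, twistedEulerLog χ u p) := by
  have h_summable := (summable_twistedEulerLog χ hu).subtype (largePrimes P)
  refine (tprod_congr fun p => ?_).trans h_summable.hasSum.cexp.tprod_eq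
  rw [Complex.ofReal_natCast, Complex.cpow_natCast]
  exact (exp_twistedEulerLog χ p.2.1.one_lt (by omega)).symm

theorem mem_classPrimes_iff {P : ℝ} {p : ℕ} (hp : p ∈ largePrimes P) {a : G q}
    (ha : (a : ZMod q) = p) {B : CyclicSubgroup q} :
    p ∈ classPrimes P B ↔ ⟨Subgroup.zpowers a, inferInstance⟩ = B := by
  refine ⟨fun ⟨_, _, b, hb, hbp⟩ => ?_, ?_⟩
  · obtain rfl : b = a := Units.ext (hbp.trans ha.symm)
    exact Subtype.ext hb
  · rintro rfl
    exact ⟨hp.1, hp.2, a, rfl, ha⟩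

theorem classPrimes_subset_largePrimes (P : ℝ) (B : CyclicSubgroup q) :
    classPrimes P B ⊆ largePrimes P :=
  fun _ hp => ⟨hp.1, hp.2.1⟩

theorem pairwise_disjoint_classPrimes (P : ℝ) :
    Pairwise (Function.onFun Disjoint (classPrimes (q := q) P)) := by
  intro B B' hB
  refine Set.disjoint_left.2 fun p hp hp' => hB ?_
  have hpP := classPrimes_subset_largePrimes P B hp
  have ⟨_, _, a, _, ha⟩ := hp
  exact ((mem_classPrimes_iff hpP ha).1 hp).symm.trans ((mem_classPrimes_iff hpP ha).1 hp')

theorem hasSum_indicator_classPrimes (P : ℝ) (B : CyclicSubgroup q) {u : ℕ} (hu : 2 ≤ u) :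
    HasSum (fun p : largePrimes P => (classPrimes P B).indicator (eulerLog u) p)
      (logZeta (classPrimes P B) u) :=
  (hasSum_subtype_iff_of_support_subset
    (Set.support_indicator_subset.trans (classPrimes_subset_largePrimes P B))).2
    (hasSum_subtype_iff_indicator.1 ((summable_eulerLog hu).subtype (classPrimes P B)).hasSum)

variable [NeZero q]

theorem sum_logZeta_classPrimes_le (P : ℝ) {u : ℕ} (hu : 2 ≤ u) :
    ∑ B : CyclicSubgroup q, logZeta (classPrimes P B) u ≤ logZeta (largePrimes P) u := by
  rw [← logZeta_biUnion ((pairwise_disjoint_classPrimes P).set_pairwise _) hu]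
  exact logZeta_mono (Set.iUnion₂_subset fun B _ => classPrimes_subset_largePrimes P B) hu

theorem sum_perp_twistedEulerLog {P : ℝ} {u : ℕ} (hu : u ≠ 0) (K : Subgroup (G q)) {p : ℕ}
    (hp : p ∈ largePrimes P) :
    ∑ χ ∈ perp K, twistedEulerLog χ u p = ((∑ B : CyclicSubgroup q, K.index / K.relIndex B.1 *
      (classPrimes P B).indicator (eulerLog (K.relIndex B.1 * u)) p : ℝ) : ℂ) := by
  by_cases hpq : IsUnit (p : ZMod q)
  · obtain ⟨a, ha⟩ := hpq
    rw [Finset.sum_eq_single_of_mem ⟨Subgroup.zpowers a, inferInstance⟩ (Finset.mem_univ _)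
      fun B _ hB => ?_]
    · simp only [twistedEulerLog]
      rw [Set.indicator_of_mem ((mem_classPrimes_iff hp ha).2 rfl), eulerLog, ← ha,
        sum_perp_neg_log K a (by positivity) (one_div_natCast_pow_lt_one hp.1.one_lt hu),
        div_pow, one_pow, ← pow_mul, mul_comm u]
    · rw [Set.indicator_of_notMem fun h => hB ((mem_classPrimes_iff hp ha).1 h).symm, mul_zero]
  · have h_notMem (B : CyclicSubgroup q) : p ∉ classPrimes P B :=
      fun ⟨_, _, a, _, ha⟩ => hpq ⟨a, ha⟩
    simp only [twistedEulerLog, MulChar.map_nonunit _ hpq, Set.indicator_of_notMem (h_notMem _),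
      zero_mul, mul_zero, sub_zero, Complex.log_one, neg_zero, Finset.sum_const_zero,
      Complex.ofReal_zero]

theorem Gam_eq_sum_logZeta (P : ℝ) {j t : ℕ} (hu : 2 ≤ t * j) (K : CyclicSubgroup q) :
    Gam P j t K = ∑ B : CyclicSubgroup q,
      K.1.index / K.1.relIndex B.1 * logZeta (classPrimes P B) (K.1.relIndex B.1 * (t * j)) := by
  have h_relIndex (B : CyclicSubgroup q) : 2 ≤ K.1.relIndex B.1 * (t * j) :=
    hu.trans (Nat.le_mul_of_pos_left _ (Nat.pos_of_ne_zero Subgroup.index_ne_zero_of_finite))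
  have h_sum := hasSum_sum (s := Finset.univ) fun B (_ : B ∈ Finset.univ) =>
    (hasSum_indicator_classPrimes P B (h_relIndex B)).mul_left (K.1.index / K.1.relIndex B.1 : ℝ)
  have h_summable (χ : DirichletCharacter ℂ q) :
      Summable fun p : largePrimes P => twistedEulerLog χ (t * j) p :=
    (summable_twistedEulerLog χ hu).subtype (largePrimes P)
  rw [Gam, ← Nat.cast_mul, Finset.prod_congr rfl fun χ _ => LP_natCast_eq_exp P χ hu,
    ← Complex.exp_sum, ← Summable.tsum_finsetSum fun χ _ => h_summable χ,
    tsum_congr fun p => sum_perp_twistedEulerLog (by omega) K.1 p.2, ← Complex.ofReal_tsum,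
    ← Complex.ofReal_exp, Complex.ofReal_re, Real.log_exp, h_sum.tsum_eq]

theorem M1inv_mulVec_Gam (P : ℝ) {j t : ℕ} (hu : 2 ≤ t * j) :
    (M1inv q).mulVec (Gam P j t) = ∑ d ∈ (expG q).divisors,
      (d : ℝ)⁻¹ • (N q d).mulVec fun B => logZeta (classPrimes P B) (d * (t * j)) := by
  classical
  funext B₀
  simp only [Finset.sum_apply, Pi.smul_apply, smul_eq_mul, Matrix.mulVec, dotProduct,
    N_apply_eq_sum_cyclicSubgroup, Finset.mul_sum, Finset.sum_mul, Gam_eq_sum_logZeta P hu,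
    Finset.sum_filter]
  rw [Finset.sum_comm]
  conv_rhs => rw [Finset.sum_comm]
  refine Finset.sum_congr rfl fun B _ => ?_
  rw [Finset.sum_comm]
  refine Finset.sum_congr rfl fun K _ => ?_
  have h_index : (K.1.index : ℝ) ≠ 0 := Nat.cast_ne_zero.2 Subgroup.index_ne_zero_of_finite
  rw [Finset.sum_eq_single_of_mem _ (relIndex_mem_divisors_expG K.1 B) fun d _ hd => ?_]
  · by_cases hK : K.1 ≤ B₀.1
    · rw [M1inv, if_pos hK, if_pos ⟨hK, rfl⟩]
      field_simp
    · rw [M1inv, if_neg hK, if_neg fun h => hK h.1, zero_mul, zero_mul, mul_zero]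
  · rw [if_neg fun h => hd h.2.symm, zero_mul, mul_zero]

end

/-! ### The iterated recursion -/

section

theorem abs_matrix_mul_apply_le {ι : Type*} [Fintype ι] {A B : Matrix ι ι ℝ} {a b : ℝ}
    (hA : ∀ i j, |A i j| ≤ a) (hB : ∀ i j, |B i j| ≤ b) (i j : ι) :
    |(A * B) i j| ≤ Fintype.card ι * (a * b) :=
  calc |(A * B) i j| ≤ ∑ k, |A i k * B k j| := by
        rw [Matrix.mul_apply]
        exact Finset.abs_sum_le_sum_abs _ _
    _ ≤ Fintype.card ι • (a * b) := by
        refine Finset.sum_le_card_nsmul _ _ _ fun k _ => ?_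
        rw [abs_mul]
        exact mul_le_mul (hA i k) (hB k j) (abs_nonneg _) ((abs_nonneg _).trans (hA i k))
    _ = Fintype.card ι * (a * b) := nsmul_eq_mul _ _

theorem abs_mulVec_apply_le {ι : Type*} [Fintype ι] {A : Matrix ι ι ℝ} {a : ℝ}
    (hA : ∀ i j, |A i j| ≤ a) {x : ι → ℝ} (hx : ∀ i, 0 ≤ x i) (i : ι) :
    |(A.mulVec x) i| ≤ a * ∑ j, x j := by
  rw [Matrix.mulVec, dotProduct, Finset.mul_sum]
  refine (Finset.abs_sum_le_sum_abs _ _).trans (Finset.sum_le_sum fun j _ => ?_)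
  rw [abs_mul, abs_of_nonneg (hx j)]
  exact mul_le_mul_of_nonneg_right (hA i j) (hx j)

theorem sum_pow_le_of_injOn {ι : Type*} {s : Finset ι} {f : ι → ℕ} (hf : Set.InjOn f s) {x : ℝ}
    (hx0 : 0 ≤ x) (hx1 : x < 1) : ∑ i ∈ s, x ^ f i ≤ (1 - x)⁻¹ := by
  rw [← tsum_geometric_of_lt_one hx0 hx1, ← Finset.sum_image (f := fun n => x ^ n) hf]
  exact (summable_geometric_of_lt_one hx0 hx1).sum_le_tsum _ fun n _ => pow_nonneg hx0 n

end

section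

variable {q r v : ℕ}

theorem mem_tuples {d : Fin v → ℕ} : d ∈ tuples q r v ↔
    (∀ i, d i ∈ (expG q).divisors.erase 1) ∧ ∏ i, d i ≤ 2 ^ r := by
  rw [tuples, Finset.mem_filter, Fintype.mem_piFinset]

theorem two_le_of_mem_divisors_erase_one {n d : ℕ} (hd : d ∈ n.divisors.erase 1) : 2 ≤ d := by
  have h_ne := Finset.ne_of_mem_erase hd
  have h_pos := Nat.pos_of_mem_divisors (Finset.mem_of_mem_erase hd)
  omega

theorem two_pow_le_prod_of_mem_tuples {d : Fin v → ℕ} (hd : d ∈ tuples q r v) :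
    2 ^ v ≤ ∏ i, d i := by
  have h := Finset.pow_card_le_prod Finset.univ d 2 fun i _ =>
    two_le_of_mem_divisors_erase_one ((mem_tuples.1 hd).1 i)
  rwa [Finset.card_univ, Fintype.card_fin] at h

theorem prod_pos_of_mem_tuples {d : Fin v → ℕ} (hd : d ∈ tuples q r v) : 0 < ∏ i, d i :=
  (pow_pos two_pos v).trans_le (two_pow_le_prod_of_mem_tuples hd)

theorem card_tuples_le (q r v : ℕ) : (tuples q r v).card ≤ (expG q).divisors.card ^ v := by
  refine (Finset.card_filter_le _ _).trans ?_
  rw [Fintype.card_piFinset_const]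
  exact Nat.pow_le_pow_left (Finset.card_le_card (Finset.erase_subset _ _)) v

theorem tuples_zero (q r : ℕ) : tuples q r 0 = {Fin.elim0} :=
  Finset.eq_singleton_iff_unique_mem.2
    ⟨mem_tuples.2 ⟨fun i => i.elim0, Nat.one_le_two_pow⟩, fun d _ => Subsingleton.elim d _⟩

theorem snoc_mem_tuples {d : Fin v → ℕ} {c : ℕ} :
    (Fin.snoc d c : Fin (v + 1) → ℕ) ∈ tuples q r (v + 1) ↔
      (d ∈ tuples q r v ∧ c ∈ (expG q).divisors.erase 1) ∧ (∏ i, d i) * c ≤ 2 ^ r := by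
  simp only [mem_tuples, Fin.forall_fin_succ', Fin.prod_univ_castSucc, Fin.snoc_castSucc,
    Fin.snoc_last]
  refine ⟨fun ⟨⟨hd, hc⟩, h⟩ => ⟨⟨⟨hd, ?_⟩, hc⟩, h⟩, fun ⟨⟨⟨hd, _⟩, hc⟩, h⟩ => ⟨⟨hd, hc⟩, h⟩⟩
  have := two_le_of_mem_divisors_erase_one hc
  exact (Nat.le_mul_of_pos_right _ (by omega)).trans h

/-- The pairs `(d, c)` of a tuple `d` in `tuples q r v` and a further divisor `c ≠ 1` of `exp G`;
such a pair stands for the tuple `d` extended by `c`, whose product may exceed `2 ^ r`. -/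
noncomputable def extensions (q r v : ℕ) : Finset ((Fin v → ℕ) × ℕ) :=
  tuples q r v ×ˢ (expG q).divisors.erase 1

/-- The extended tuples at which the recursion truncated to depth `r` stops: those whose product
exceeds `2 ^ r`, and all those of length `r`. -/
noncomputable def overflow (q r v : ℕ) : Finset ((Fin v → ℕ) × ℕ) :=
  {x ∈ extensions q r v | 2 ^ r < (∏ i, x.1 i) * x.2 ∨ v + 1 = r}

theorem two_pow_le_prod_mul_of_mem_overflow {x : (Fin v → ℕ) × ℕ} (hx : x ∈ overflow q r v) :
    2 ^ r ≤ (∏ i, x.1 i) * x.2 := by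
  obtain ⟨hx, h | rfl⟩ := Finset.mem_filter.1 hx
  · exact h.le
  · obtain ⟨hd, hc⟩ := Finset.mem_product.1 hx
    rw [pow_succ]
    exact Nat.mul_le_mul (two_pow_le_prod_of_mem_tuples hd) (two_le_of_mem_divisors_erase_one hc)

theorem sum_tuples_succ {M : Type*} [AddCommMonoid M] (f : (Fin (v + 1) → ℕ) → M) :
    ∑ e ∈ tuples q r (v + 1), f e =
      ∑ x ∈ extensions q r v with (∏ i, x.1 i) * x.2 ≤ 2 ^ r, f (Fin.snoc x.1 x.2) := by
  symm
  refine Finset.sum_equiv ((Equiv.prodComm _ _).trans (Fin.snocEquiv fun _ => ℕ))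
    (fun x => ?_) fun x _ => rfl
  rw [Finset.mem_filter, extensions, Finset.mem_product]
  exact snoc_mem_tuples.symm

theorem sum_overflow_pow_le (q r v : ℕ) {x : ℝ} (hx0 : 0 ≤ x) (hx1 : x < 1) :
    ∑ y ∈ overflow q r v, x ^ ((∏ i, y.1 i) * y.2 - 2 ^ r) ≤
      (expG q).divisors.card ^ v * (1 - x)⁻¹ := by
  have h_fiber (d : Fin v → ℕ) (hd : d ∈ tuples q r v) :
      ∑ c ∈ (expG q).divisors.erase 1 with 2 ^ r ≤ (∏ i, d i) * c,
        x ^ ((∏ i, d i) * c - 2 ^ r) ≤ (1 - x)⁻¹ := by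
    refine sum_pow_le_of_injOn (fun c hc c' hc' h => ?_) hx0 hx1
    have h_le := (Finset.mem_filter.1 (Finset.mem_coe.1 hc)).2
    have h_le' := (Finset.mem_filter.1 (Finset.mem_coe.1 hc')).2
    exact Nat.eq_of_mul_eq_mul_left (prod_pos_of_mem_tuples hd) (by omega)
  calc ∑ y ∈ overflow q r v, x ^ ((∏ i, y.1 i) * y.2 - 2 ^ r)
      ≤ ∑ y ∈ extensions q r v with 2 ^ r ≤ (∏ i, y.1 i) * y.2,
          x ^ ((∏ i, y.1 i) * y.2 - 2 ^ r) := by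
        refine Finset.sum_le_sum_of_subset_of_nonneg (fun y hy => ?_)
          fun y _ _ => pow_nonneg hx0 _
        exact Finset.mem_filter.2
          ⟨Finset.mem_of_mem_filter y hy, two_pow_le_prod_mul_of_mem_overflow hy⟩
    _ = ∑ d ∈ tuples q r v, ∑ c ∈ (expG q).divisors.erase 1 with 2 ^ r ≤ (∏ i, d i) * c,
          x ^ ((∏ i, d i) * c - 2 ^ r) := by
        refine Finset.sum_finset_product _ _ _ fun y => ?_
        rw [extensions, Finset.mem_filter, Finset.mem_product, Finset.mem_filter, and_assoc]
    _ ≤ (tuples q r v).card • (1 - x)⁻¹ := Finset.sum_le_card_nsmul _ _ _ h_fiber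
    _ ≤ (expG q).divisors.card ^ v * (1 - x)⁻¹ := by
        rw [nsmul_eq_mul]
        have h_card := card_tuples_le q r v
        have : 0 ≤ (1 - x)⁻¹ := inv_nonneg.2 (sub_nonneg.2 hx1.le)
        gcongr
        exact_mod_cast h_card

end

section

variable {q : ℕ} [NeZero q]

open Classical in
/-- The product `(N_{d₁}/d₁) ⋯ (N_{d_v}/d_v)`. -/
noncomputable def normProd (q : ℕ) [NeZero q] {v : ℕ} (d : Fin v → ℕ) :
    Matrix (CyclicSubgroup q) (CyclicSubgroup q) ℝ :=
  (List.ofFn fun i => (d i : ℝ)⁻¹ • N q (d i)).prod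

open Classical in
theorem normProd_zero (d : Fin 0 → ℕ) : normProd q d = 1 := by
  rw [normProd, List.ofFn_zero, List.prod_nil]

theorem normProd_succ {v : ℕ} (d : Fin (v + 1) → ℕ) :
    normProd q d = ((d 0 : ℝ)⁻¹ • N q (d 0)) * normProd q (Fin.tail d) := by
  classical
  rw [normProd, List.ofFn_succ, List.prod_cons]
  rfl

theorem normProd_snoc {v : ℕ} (d : Fin v → ℕ) (c : ℕ) :
    normProd q (Fin.snoc d c : Fin (v + 1) → ℕ) = normProd q d * ((c : ℝ)⁻¹ • N q c) := by
  classical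
  rw [normProd, List.ofFn_succ', List.concat_eq_append, List.prod_append, List.prod_singleton,
    normProd]
  simp only [Fin.snoc_castSucc, Fin.snoc_last]

omit [NeZero q] in
theorem abs_inv_smul_N_apply_le (c : ℕ) (B₀ B₁ : CyclicSubgroup q) :
    |((c : ℝ)⁻¹ • N q c) B₀ B₁| ≤ (c : ℝ)⁻¹ := by
  have hc : (0 : ℝ) ≤ (c : ℝ)⁻¹ := by positivity
  rw [Matrix.smul_apply, smul_eq_mul, abs_mul, abs_of_nonneg hc]
  exact mul_le_of_le_one_right hc (abs_N_apply_le_one c B₀ B₁)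

theorem abs_normProd_mul_apply_le {v : ℕ} (d : Fin v → ℕ) (c : ℕ) (B₀ B₁ : CyclicSubgroup q) :
    |(normProd q d * ((c : ℝ)⁻¹ • N q c)) B₀ B₁| ≤
      (Fintype.card (CyclicSubgroup q) : ℝ) ^ v * (((∏ i, d i) * c : ℕ) : ℝ)⁻¹ := by
  classical
  induction v generalizing B₀ B₁ with
  | zero =>
    rw [normProd_zero, one_mul, pow_zero, one_mul, Fin.prod_univ_zero, one_mul]
    exact abs_inv_smul_N_apply_le c B₀ B₁
  | succ v ih =>
    rw [normProd_succ, mul_assoc]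
    refine (abs_matrix_mul_apply_le (abs_inv_smul_N_apply_le (d 0)) (ih (Fin.tail d))
      B₀ B₁).trans_eq ?_
    rw [Fin.prod_univ_succ, pow_succ]
    push_cast
    simp only [mul_inv, Fin.tail]
    ring

/-- The vector of the logarithms of the partial zeta functions of all classes at `t * j`, which
`M₁⁻¹ Γ_j(t)` approximates. -/
noncomputable def classLogZeta (q : ℕ) (P : ℝ) (j t : ℕ) : CyclicSubgroup q → ℝ :=
  fun B => logZeta (classPrimes P B) (t * j)

/-- The term that the extended tuple `(d, c)` contributes to the iterated recursion. -/
noncomputable def recTerm (q : ℕ) [NeZero q] (P : ℝ) (j : ℕ) {v : ℕ} (x : (Fin v → ℕ) × ℕ) :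
    CyclicSubgroup q → ℝ :=
  (normProd q x.1 * ((x.2 : ℝ)⁻¹ • N q x.2)).mulVec (classLogZeta q P j ((∏ i, x.1 i) * x.2))

/-- The sum of the recursion terms over the tuples in `tuples q r v`. -/
noncomputable def levelSum (q : ℕ) [NeZero q] (P : ℝ) (j r v : ℕ) : CyclicSubgroup q → ℝ :=
  ∑ d ∈ tuples q r v, (normProd q d).mulVec (classLogZeta q P j (∏ i, d i))

theorem levelSum_zero (P : ℝ) (j r : ℕ) : levelSum q P j r 0 = classLogZeta q P j 1 := by
  classical
  rw [levelSum, tuples_zero, Finset.sum_singleton, normProd_zero, Matrix.one_mulVec,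
    Fin.prod_univ_zero]

theorem levelSum_succ (P : ℝ) (j r v : ℕ) : levelSum q P j r (v + 1) =
    ∑ x ∈ extensions q r v with (∏ i, x.1 i) * x.2 ≤ 2 ^ r, recTerm q P j x := by
  rw [levelSum, sum_tuples_succ]
  simp only [normProd_snoc, Fin.prod_univ_castSucc, Fin.snoc_castSucc, Fin.snoc_last, recTerm]

variable (P : ℝ) {j : ℕ} (hj : 2 ≤ j)
include hj

theorem M1inv_mulVec_Gam_eq_add {t : ℕ} (ht : 0 < t) :
    (M1inv q).mulVec (Gam P j t) = classLogZeta q P j t + ∑ c ∈ (expG q).divisors.erase 1,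
      ((c : ℝ)⁻¹ • N q c).mulVec (classLogZeta q P j (t * c)) := by
  classical
  have h_one : 1 ∈ (expG q).divisors :=
    Nat.one_mem_divisors.2 Monoid.exponent_ne_zero_of_finite
  rw [M1inv_mulVec_Gam P (hj.trans (Nat.le_mul_of_pos_left j ht)),
    ← Finset.add_sum_erase _ _ h_one, N_one]
  simp only [Nat.cast_one, inv_one, one_smul, Matrix.one_mulVec, one_mul, Matrix.smul_mulVec]
  refine congrArg _ (Finset.sum_congr rfl fun c _ => ?_)
  have h_assoc : c * (t * j) = t * c * j := by ring
  rw [h_assoc]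
  rfl

theorem sum_normProd_mulVec_Gam (r v : ℕ) :
    ∑ d ∈ tuples q r v, (normProd q d * M1inv q).mulVec (Gam P j (∏ i, d i)) =
      levelSum q P j r v + (if v + 1 = r then 0 else levelSum q P j r (v + 1)) +
        ∑ x ∈ overflow q r v, recTerm q P j x := by
  have h_level : ∑ d ∈ tuples q r v, (normProd q d * M1inv q).mulVec (Gam P j (∏ i, d i)) =
      levelSum q P j r v + ∑ x ∈ extensions q r v, recTerm q P j x := by
    rw [levelSum, extensions, Finset.sum_product, ← Finset.sum_add_distrib]
    refine Finset.sum_congr rfl fun d hd => ?_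
    rw [← Matrix.mulVec_mulVec, M1inv_mulVec_Gam_eq_add P hj (prod_pos_of_mem_tuples hd),
      Matrix.mulVec_add, Matrix.mulVec_sum]
    simp only [recTerm, Matrix.mulVec_mulVec]
  rw [h_level, add_assoc, overflow]
  split_ifs with hvr
  · simp only [hvr, or_true, Finset.filter_true, zero_add]
  · simp only [hvr, or_false, levelSum_succ, ← not_le]
    rw [Finset.sum_filter_add_sum_filter_not]

theorem approxVec_eq (r : ℕ) : approxVec q P j (r + 1) = classLogZeta q P j 1 +
    ∑ v ∈ Finset.range (r + 1), (-1 : ℝ) ^ v • ∑ x ∈ overflow q (r + 1) v, recTerm q P j x := by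
  set L : ℕ → CyclicSubgroup q → ℝ := fun v =>
    (-1 : ℝ) ^ v • if v = r + 1 then 0 else levelSum q P j (r + 1) v with hL
  have h_telescope : ∑ v ∈ Finset.range (r + 1), (L v - L (v + 1)) = classLogZeta q P j 1 := by
    rw [Finset.sum_range_sub', hL]
    simp only [if_true, smul_zero, sub_zero, pow_zero, one_smul, levelSum_zero,
      if_neg (Nat.succ_ne_zero r).symm]
  rw [← h_telescope, ← Finset.sum_add_distrib]
  refine Finset.sum_congr rfl fun v hv => ?_
  have hv := Finset.mem_range.1 hv
  refine (congrArg _ (sum_normProd_mulVec_Gam P hj (r + 1) v)).trans ?_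
  rw [hL]
  simp only [if_neg hv.ne, pow_succ]
  module

variable {P} (hP : 4 ≤ P)
include hP

theorem logZeta_largePrimes_add_mul_le {u : ℕ} (hu : 2 ≤ u) (m : ℕ) :
    logZeta (largePrimes P) (u + m * j) ≤ (1 / 16) ^ m * logZeta (largePrimes P) u := by
  have hT := logZeta_nonneg (largePrimes P) u
  refine (logZeta_add_le (fun p hp => hp.2) (by linarith) hu (m * j)).trans ?_
  rw [div_pow, one_pow]
  gcongr
  calc (16 : ℝ) ^ m = 4 ^ (m * 2) := by rw [mul_comm, pow_mul]; norm_num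
    _ ≤ 4 ^ (m * j) := pow_le_pow_right₀ (by norm_num) (Nat.mul_le_mul_left m hj)
    _ ≤ P ^ (m * j) := by gcongr

theorem abs_recTerm_le {r v : ℕ} {x : (Fin v → ℕ) × ℕ} (hx : x ∈ overflow q r v)
    (B : CyclicSubgroup q) : |recTerm q P j x B| ≤
      (Fintype.card (CyclicSubgroup q) : ℝ) ^ v * (2 ^ r)⁻¹ *
        logZeta (largePrimes P) (2 ^ r * j) * (1 / 16) ^ ((∏ i, x.1 i) * x.2 - 2 ^ r) := by
  obtain ⟨m, hm⟩ := Nat.exists_eq_add_of_le (two_pow_le_prod_mul_of_mem_overflow hx)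
  have hu : 2 ≤ 2 ^ r * j := hj.trans (Nat.le_mul_of_pos_left j (by positivity))
  have h_matrix (B₀ B₁ : CyclicSubgroup q) :
      |(normProd q x.1 * ((x.2 : ℝ)⁻¹ • N q x.2)) B₀ B₁| ≤
        (Fintype.card (CyclicSubgroup q) : ℝ) ^ v * (2 ^ r)⁻¹ := by
    refine (abs_normProd_mul_apply_le x.1 x.2 B₀ B₁).trans ?_
    gcongr
    exact_mod_cast hm ▸ Nat.le_add_right (2 ^ r) m
  have h_tail : ∑ B' : CyclicSubgroup q, classLogZeta q P j ((∏ i, x.1 i) * x.2) B' ≤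
      (1 / 16) ^ m * logZeta (largePrimes P) (2 ^ r * j) := by
    simp only [classLogZeta, hm, add_mul]
    exact (sum_logZeta_classPrimes_le P (by omega)).trans
      (logZeta_largePrimes_add_mul_le hj hP hu m)
  rw [hm, Nat.add_sub_cancel_left, recTerm, mul_right_comm, mul_assoc]
  refine (abs_mulVec_apply_le h_matrix (fun B' => logZeta_nonneg _ _) B).trans ?_
  gcongr
  exact h_tail

theorem abs_sum_overflow_recTerm_le (r v : ℕ) (B : CyclicSubgroup q) :
    |∑ x ∈ overflow q r v, recTerm q P j x B| ≤
      ((Fintype.card (CyclicSubgroup q) : ℝ) * (expG q).divisors.card) ^ v *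
        ((2 ^ r)⁻¹ * (16 / 15 * logZeta (largePrimes P) (2 ^ r * j))) := by
  set T := logZeta (largePrimes P) (2 ^ r * j)
  have hT : 0 ≤ T := logZeta_nonneg _ _
  calc |∑ x ∈ overflow q r v, recTerm q P j x B|
      ≤ ∑ x ∈ overflow q r v, (Fintype.card (CyclicSubgroup q) : ℝ) ^ v * (2 ^ r)⁻¹ * T *
          (1 / 16) ^ ((∏ i, x.1 i) * x.2 - 2 ^ r) :=
        (Finset.abs_sum_le_sum_abs _ _).trans
          (Finset.sum_le_sum fun x hx => abs_recTerm_le hj hP hx B)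
    _ ≤ (Fintype.card (CyclicSubgroup q) : ℝ) ^ v * (2 ^ r)⁻¹ * T *
          ((expG q).divisors.card ^ v * (1 - 1 / 16)⁻¹) := by
        rw [← Finset.mul_sum]
        gcongr
        exact sum_overflow_pow_le q r v (by norm_num) (by norm_num)
    _ = _ := by
        rw [mul_pow]
        ring

theorem abs_approxVec_sub_logZeta_le (r : ℕ) (B : CyclicSubgroup q) :
    |approxVec q P j (r + 1) B - logZeta (classPrimes P B) j| ≤ (r + 1) *
      (((Fintype.card (CyclicSubgroup q) : ℝ) * (expG q).divisors.card / 2) ^ r *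
        (8 / 15 * logZeta (largePrimes P) (2 ^ (r + 1) * j))) := by
  set X := (Fintype.card (CyclicSubgroup q) : ℝ) * (expG q).divisors.card with hX
  set T := logZeta (largePrimes P) (2 ^ (r + 1) * j)
  have hT : 0 ≤ T := logZeta_nonneg _ _
  have hX_one : 1 ≤ X := by
    have h_card : 0 < Fintype.card (CyclicSubgroup q) := Fintype.card_pos_iff.2 ⟨B⟩
    have h_divisors : 0 < (expG q).divisors.card :=
      Finset.card_pos.2 ⟨1, Nat.one_mem_divisors.2 Monoid.exponent_ne_zero_of_finite⟩
    rw [hX]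
    exact_mod_cast Nat.mul_pos h_card h_divisors
  have h_diff : approxVec q P j (r + 1) B - logZeta (classPrimes P B) j =
      ∑ v ∈ Finset.range (r + 1), (-1 : ℝ) ^ v * ∑ x ∈ overflow q (r + 1) v, recTerm q P j x B := by
    simp only [approxVec_eq P hj, classLogZeta, one_mul, Pi.add_apply, Finset.sum_apply,
      Pi.smul_apply, smul_eq_mul, add_sub_cancel_left]
  calc |approxVec q P j (r + 1) B - logZeta (classPrimes P B) j|
      ≤ ∑ v ∈ Finset.range (r + 1), X ^ r * ((2 ^ (r + 1))⁻¹ * (16 / 15 * T)) := by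
        rw [h_diff]
        refine (Finset.abs_sum_le_sum_abs _ _).trans (Finset.sum_le_sum fun v hv => ?_)
        rw [abs_mul, abs_pow, abs_neg, abs_one, one_pow, one_mul]
        refine (abs_sum_overflow_recTerm_le hj hP (r + 1) v B).trans ?_
        gcongr
        exact Finset.mem_range_succ_iff.1 hv
    _ = (r + 1) * ((X / 2) ^ r * (8 / 15 * T)) := by
        rw [Finset.sum_const, Finset.card_range, nsmul_eq_mul, div_pow, pow_succ]
        push_cast
        field_simp
        ring

end

/-! ### Error estimates -/

section

variable {c : ℕ → ℝ} {M β P : ℝ} {S : Set ℕ}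

theorem mul_inv_le_half (hβ : 2 ≤ β) {x : ℝ} (hx : 2 * β ≤ x) : β * (1 / x) ≤ 1 / 2 := by
  rw [mul_one_div, div_le_div_iff₀ (by linarith) (by norm_num)]
  linarith

variable (hM : 0 ≤ M) (hβ : 2 ≤ β) (hP : 2 * β ≤ P) (hS : ∀ n ∈ S, P ≤ n)
include hM hβ hP hS

theorem summable_mul_eulerLog (hc01 : ∀ k < 2, c k = 0) (hc : ∀ k, |c k| ≤ M * β ^ k) :
    Summable fun x : S × ℕ => c x.2 * eulerLog x.2 x.1 := by
  have h_bound := ((summable_one_div_natCast_pow le_rfl S).mul_left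
    (16 / 15 * M * β ^ 2 * 4)).mul_of_nonneg summable_geometric_two
    (fun n => by positivity) fun j => by positivity
  refine .of_norm_bounded h_bound fun ⟨n, j⟩ => ?_
  obtain hj | hj := lt_or_ge j 2
  · rw [hc01 j hj, zero_mul, norm_zero]
    positivity
  obtain ⟨i, rfl⟩ := Nat.exists_eq_add_of_le hj
  have hPn : P ≤ (n : ℕ) := hS n n.2
  have hn : 4 ≤ (n : ℕ) := by exact_mod_cast (by linarith : (4 : ℝ) ≤ (n : ℕ))
  rw [Real.norm_eq_abs, abs_mul, abs_of_nonneg (eulerLog_nonneg _ _)]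
  calc |c (2 + i)| * eulerLog (2 + i) n
      ≤ M * β ^ (2 + i) * (16 / 15 * (1 / (n : ℝ) ^ (2 + i))) :=
        mul_le_mul (hc _) (eulerLog_le hn hj) (eulerLog_nonneg _ _) (by positivity)
    _ = 16 / 15 * M * β ^ 2 * (1 / (n : ℝ) ^ 2) * (β * (1 / (n : ℝ))) ^ i := by
        rw [pow_add, pow_add, mul_pow, one_div_pow, ← one_div_mul_one_div]
        ring
    _ ≤ 16 / 15 * M * β ^ 2 * (1 / (n : ℝ) ^ 2) * (1 / 2) ^ i := by
        gcongr
        exact mul_inv_le_half hβ (hP.trans hPn)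
    _ = 16 / 15 * M * β ^ 2 * 4 * (1 / (n : ℝ) ^ 2) * (1 / 2) ^ (2 + i) := by
        rw [pow_add]
        ring

theorem exists_hasSum_and_hasSum_mul_logZeta (hc01 : ∀ k < 2, c k = 0)
    (hc : ∀ k, |c k| ≤ M * β ^ k) {f : ℕ → ℝ}
    (hf : ∀ n ∈ S, HasSum (fun j => c j * eulerLog j n) (f n)) :
    ∃ Λ, HasSum (fun n : S => f n) Λ ∧ HasSum (fun j => c j * logZeta S j) Λ := by
  have h_sum := (summable_mul_eulerLog hM hβ hP hS hc01 hc).hasSum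
  refine ⟨_, h_sum.prod_fiberwise fun n => hf n n.2,
    ((Equiv.prodComm _ _).hasSum_iff.2 h_sum).prod_fiberwise fun j => ?_⟩
  obtain hj | hj := lt_or_ge j 2
  · simpa only [Function.comp_def, Equiv.prodComm_apply, Prod.swap_prod_mk, hc01 j hj, zero_mul]
      using hasSum_zero
  · exact ((summable_eulerLog hj).subtype S).hasSum.mul_left (c j)

theorem abs_mul_logZeta_add_le (hc : ∀ k, |c k| ≤ 4 * M * β ^ k / k) {u : ℕ} (hu : 2 ≤ u)
    (i : ℕ) : |c (i + u) * logZeta S (i + u)| ≤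
      4 * M * β ^ u / u * logZeta S u * (1 / 2) ^ i := by
  have hT := logZeta_nonneg S u
  have : (0 : ℝ) < u := by exact_mod_cast (by omega : 0 < u)
  have hcu : |c (u + i)| ≤ 4 * M * β ^ (u + i) / u := by
    refine (hc _).trans ?_
    gcongr
    exact Nat.le_add_right u i
  rw [add_comm i u, abs_mul, abs_of_nonneg (logZeta_nonneg S (u + i))]
  calc |c (u + i)| * logZeta S (u + i)
      ≤ 4 * M * β ^ (u + i) / u * (1 / P ^ i * logZeta S u) :=
        mul_le_mul hcu (logZeta_add_le hS (by linarith) hu i) (logZeta_nonneg _ _) (by positivity)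
    _ = 4 * M * β ^ u / u * logZeta S u * (β * (1 / P)) ^ i := by
        rw [pow_add, mul_pow, one_div_pow]
        ring
    _ ≤ 4 * M * β ^ u / u * logZeta S u * (1 / 2) ^ i := by
        have : 0 ≤ β * (1 / P) := mul_nonneg (by linarith) (one_div_nonneg.2 (by linarith))
        gcongr
        exact mul_inv_le_half hβ hP

theorem abs_tsum_mul_logZeta_le (hc : ∀ k, |c k| ≤ 4 * M * β ^ k / k) {J : ℕ} (hJ : 3 ≤ J) :
    |∑' i, c (i + (J + 1)) * logZeta S (i + (J + 1))| ≤ M * (4 * β ^ (J + 1) / (J * P ^ J)) := by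
  have hJ' : (3 : ℝ) ≤ J := by exact_mod_cast hJ
  have hP4 : 4 ≤ P := by linarith
  have h_inv : 1 / P ≤ 1 / 4 := one_div_le_one_div_of_le (by norm_num) hP4
  have h_logZeta : logZeta S (J + 1) * 2 ≤ (J + 1) / (J * P ^ J) :=
    calc logZeta S (J + 1) * 2 ≤ 16 / 15 * (1 / P ^ (J + 1) * (1 + P / J)) * 2 := by
          gcongr
          exact logZeta_le hS hP4 (by omega)
      _ = 32 / 15 * (J * (1 / P) + 1) / (J * P ^ J) := by
          rw [pow_succ P]
          field_simp
          ring
      _ ≤ (J + 1) / (J * P ^ J) := by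
          gcongr
          nlinarith
  calc |∑' i, c (i + (J + 1)) * logZeta S (i + (J + 1))|
      ≤ 4 * M * β ^ (J + 1) / (J + 1 : ℕ) * logZeta S (J + 1) * 2 :=
        tsum_of_norm_bounded (f := fun i => c (i + (J + 1)) * logZeta S (i + (J + 1)))
          (hasSum_geometric_two.mul_left _)
          (abs_mul_logZeta_add_le hM hβ hP hS hc (by omega))
    _ ≤ 4 * M * β ^ (J + 1) / (J + 1 : ℕ) * ((J + 1) / (J * P ^ J)) := by
        rw [mul_assoc]
        gcongr
    _ = M * (4 * β ^ (J + 1) / (J * P ^ J)) := by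
        push_cast
        field_simp

theorem sum_Icc_abs_mul_le (hc : ∀ k, |c k| ≤ M * β ^ k) {e : ℕ → ℝ} {R : ℝ} (hR : 0 ≤ R) {Q : ℕ}
    (hQ : 2 ≤ Q) (he : ∀ j ≥ 2, |e j| ≤ R * logZeta S (Q * j)) (J : ℕ) :
    ∑ j ∈ Finset.Icc 2 J, |c j * e j| ≤ 8 / 7 * (M * β ^ 2 * R * logZeta S (Q * 2)) := by
  have hT := logZeta_nonneg S (Q * 2)
  have h_ratio : β * (1 / P ^ Q) ≤ 1 / 8 := by
    have h_pow : P ^ 2 ≤ P ^ Q := pow_le_pow_right₀ (by linarith) hQ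
    rw [mul_one_div, div_le_div_iff₀ (by nlinarith) (by norm_num)]
    nlinarith
  have h_ratio_nonneg : 0 ≤ β * (1 / P ^ Q) := by
    have : 0 ≤ P := by linarith
    positivity
  have h_term (i : ℕ) :
      |c (2 + i) * e (2 + i)| ≤ M * β ^ 2 * R * logZeta S (Q * 2) * (1 / 8) ^ i :=
    calc |c (2 + i) * e (2 + i)|
        ≤ M * β ^ (2 + i) * (R * (1 / P ^ (Q * i) * logZeta S (Q * 2))) := by
          rw [abs_mul]
          refine mul_le_mul (hc _) ((he _ (by omega)).trans ?_) (abs_nonneg _) (by positivity)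
          rw [mul_add]
          gcongr
          exact logZeta_add_le hS (by linarith) (by omega) _
      _ = M * β ^ 2 * R * logZeta S (Q * 2) * (β * (1 / P ^ Q)) ^ i := by
          rw [pow_add, mul_pow, one_div_pow, ← pow_mul]
          ring
      _ ≤ M * β ^ 2 * R * logZeta S (Q * 2) * (1 / 8) ^ i := by gcongr
  have h_geom : ∑ i ∈ Finset.range (J + 1 - 2), (1 / 8 : ℝ) ^ i ≤ 8 / 7 :=
    (sum_pow_le_of_injOn Function.injective_id.injOn (by norm_num) (by norm_num)).trans_eq
      (by norm_num)
  calc ∑ j ∈ Finset.Icc 2 J, |c j * e j|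
      = ∑ i ∈ Finset.range (J + 1 - 2), |c (2 + i) * e (2 + i)| :=
        Finset.sum_Ico_eq_sum_range (fun j => |c j * e j|) 2 (J + 1)
    _ ≤ ∑ i ∈ Finset.range (J + 1 - 2), M * β ^ 2 * R * logZeta S (Q * 2) * (1 / 8) ^ i :=
        Finset.sum_le_sum fun i _ => h_term i
    _ ≤ 8 / 7 * (M * β ^ 2 * R * logZeta S (Q * 2)) := by
        rw [← Finset.mul_sum, mul_comm]
        gcongr

omit hM in
theorem logZeta_mul_two_le {Q : ℕ} (hQ : Q ≠ 0) :
    logZeta S (Q * 2) ≤ 16 / 15 * (1 / P ^ (Q * 2) * (1 + P / Q)) := by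
  obtain ⟨m, hm⟩ : ∃ m, Q * 2 = m + 1 := ⟨Q * 2 - 1, by omega⟩
  rw [hm]
  refine (logZeta_le hS (by linarith) (by omega)).trans ?_
  have hP0 : 0 ≤ P := by linarith
  have : (0 : ℝ) < Q := by exact_mod_cast Nat.pos_of_ne_zero hQ
  gcongr
  omega

end

theorem abs_sub_sum_Icc_le {c z : ℕ → ℝ} (hc01 : ∀ k < 2, c k = 0) {s : ℝ}
    (hs : HasSum (fun j => c j * z j) s) (a : ℕ → ℝ) (J : ℕ) :
    |s - ∑ j ∈ Finset.Icc 2 J, c j * a j| ≤ ∑ j ∈ Finset.Icc 2 J, |c j * (z j - a j)| +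
      |∑' i, c (i + (J + 1)) * z (i + (J + 1))| := by
  have h_Icc : ∑ j ∈ Finset.range (J + 1), c j * z j = ∑ j ∈ Finset.Icc 2 J, c j * z j := by
    refine (Finset.sum_subset (fun j hj => ?_) fun j hj hj' => ?_).symm
    · rw [Finset.mem_Icc] at hj
      exact Finset.mem_range.2 (by omega)
    · rw [Finset.mem_range] at hj
      rw [Finset.mem_Icc] at hj'
      rw [hc01 j (by omega), zero_mul]
  rw [← hs.tsum_eq, ← hs.summable.sum_add_tsum_nat_add (J + 1), h_Icc, add_sub_right_comm,
    ← Finset.sum_sub_distrib]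
  simp only [← mul_sub]
  exact (abs_add_le _ _).trans (add_le_add_left (Finset.abs_sum_le_sum_abs _ _) _)

theorem classPrimes_span {q : ℕ} (P : ℝ) (A : LatticeClass q) : classPrimes P A.span =
    {p : ℕ | p.Prime ∧ P ≤ (p : ℝ) ∧ ∃ a ∈ A.1, (a : ZMod q) = (p : ZMod q)} := by
  rw [classPrimes, A.generators_span]

theorem card_latticeClass (q : ℕ) [NeZero q] :
    Nat.card (LatticeClass q) = Fintype.card (CyclicSubgroup q) := by
  rw [← Nat.card_eq_fintype_card]
  exact Nat.card_congr
    { toFun := LatticeClass.span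
      invFun := fun K => ⟨generators K.1, K.1, K.2, rfl⟩
      left_inv := fun A => Subtype.ext A.generators_span
      right_inv := fun K => Subtype.ext (closure_generators K.1 K.2) }

theorem sum_abs_mul_logZeta_sub_approxVec_le {c : ℕ → ℝ} {M β P : ℝ} (hM : 0 ≤ M) (hβ : 2 ≤ β)
    (hP : 2 * β ≤ P) (hc : ∀ k, |c k| ≤ 3 / 2 * M * β ^ k) {q : ℕ} [NeZero q]
    (B : CyclicSubgroup q) (J : ℕ) {r : ℕ} (hr : 1 ≤ r) :
    ∑ j ∈ Finset.Icc 2 J, |c j * (logZeta (classPrimes P B) j - approxVec q P j r B)| ≤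
      M * (((Nat.card (LatticeClass q) : ℝ) * (expG q).divisors.card / 2) ^ (r - 1) *
        (r * β ^ 2 / P ^ 2 ^ (r + 1)) * (1 + P / 2 ^ r)) := by
  obtain ⟨r, rfl⟩ := Nat.exists_eq_add_of_le' hr
  rw [card_latticeClass, Nat.add_sub_cancel]
  set X := ((Fintype.card (CyclicSubgroup q) : ℝ) * (expG q).divisors.card / 2) ^ r
  have h_nonneg : 0 ≤ M * (X * (((r + 1 : ℕ) : ℝ) * β ^ 2 / P ^ 2 ^ (r + 1 + 1)) *
      (1 + P / 2 ^ (r + 1))) := by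
    have : 0 ≤ P := by linarith
    positivity
  have h_approx (j : ℕ) (hj : j ≥ 2) : |logZeta (classPrimes P B) j - approxVec q P j (r + 1) B| ≤
      (r + 1) * (X * (8 / 15)) * logZeta (largePrimes P) (2 ^ (r + 1) * j) := by
    rw [abs_sub_comm]
    refine (abs_approxVec_sub_logZeta_le hj (by linarith) r B).trans_eq ?_
    ring
  have hS (p : ℕ) (hp : p ∈ largePrimes P) : P ≤ p := hp.2
  have h_logZeta := logZeta_mul_two_le hβ hP hS (Q := 2 ^ (r + 1)) (by positivity)
  calc _ ≤ 8 / 7 * (3 / 2 * M * β ^ 2 * ((r + 1) * (X * (8 / 15))) *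
          logZeta (largePrimes P) (2 ^ (r + 1) * 2)) :=
        sum_Icc_abs_mul_le (by positivity) hβ hP hS hc (by positivity)
          (Nat.le_self_pow (Nat.succ_ne_zero r) 2) h_approx J
    _ ≤ 8 / 7 * (3 / 2 * M * β ^ 2 * ((r + 1) * (X * (8 / 15))) *
          (16 / 15 * (1 / P ^ (2 ^ (r + 1) * 2) * (1 + P / (2 ^ (r + 1) : ℕ))))) := by gcongr
    _ = 512 / 525 * (M * (X * (((r + 1 : ℕ) : ℝ) * β ^ 2 / P ^ 2 ^ (r + 1 + 1)) *
          (1 + P / 2 ^ (r + 1)))) := by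
        rw [← pow_succ 2 (r + 1)]
        push_cast
        ring
    _ ≤ _ := mul_le_of_le_one_left h_nonneg (by norm_num)

section

open Polynomial

variable {F G : ℝ[X]} {β P : ℝ} (hβF : ∀ ρ ∈ F.aroots ℂ, ‖ρ⁻¹‖ ≤ β)
  (hβG : ∀ ρ ∈ G.aroots ℂ, ‖ρ⁻¹‖ ≤ β) (hβ : 2 ≤ β)
  (hF0 : F.eval 0 = 1) (hG0 : G.eval 0 = 1) (hX : X ^ 2 ∣ F - G)
include hF0 hG0 hX

theorem wittExp_sub_eq_zero_of_lt_two (k : ℕ) (hk : k < 2) : wittExp G k - wittExp F k = 0 := by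
  interval_cases k
  · rw [wittExp_zero, wittExp_zero, sub_zero]
  · rw [wittExp_one_eq hF0 hG0 hX, sub_self]

include hβF hβG hβ

theorem abs_wittExp_sub_le_mul_pow (k : ℕ) :
    |wittExp G k - wittExp F k| ≤ 3 / 2 * (max F.natDegree G.natDegree : ℝ) * β ^ k := by
  obtain hk | hk := lt_or_ge k 2
  · rw [wittExp_sub_eq_zero_of_lt_two hF0 hG0 hX k hk, abs_zero]
    positivity
  · exact abs_wittExp_sub_le_of_two_le hβF hβG hβ hk

theorem exists_hasProd_and_hasSum_wittExp_mul_logZeta (hP : 2 * β ≤ P) {q : ℕ}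
    (A : LatticeClass q) : ∃ Λ : ℝ,
    HasProd (fun p : PrimesIn P A => F.eval (1 / (p.1 : ℝ)) / G.eval (1 / (p.1 : ℝ)))
      (Real.exp Λ) ∧
    HasSum (fun j => (wittExp G j - wittExp F j) * logZeta (classPrimes P A.span) j) Λ := by
  have hS (p : ℕ) (hp : p ∈ classPrimes P A.span) : P ≤ p := hp.2.1
  have h_half (p : ℕ) (hp : P ≤ p) : β * (1 / (p : ℝ)) ≤ 1 / 2 := mul_inv_le_half hβ (hP.trans hp)
  have h_log (p : ℕ) (hp : P ≤ p) : HasSum (fun j => (wittExp G j - wittExp F j) * eulerLog j p)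
      (Real.log (F.eval (1 / (p : ℝ)) / G.eval (1 / (p : ℝ)))) := by
    simp only [eulerLog, ← one_div_pow]
    exact hasSum_wittExp_sub hβF hβG hβ hF0 hG0 (by positivity) (h_half p hp)
  have h_exp_log (p : ℕ) (hp : P ≤ p) :
      Real.exp (Real.log (F.eval (1 / (p : ℝ)) / G.eval (1 / (p : ℝ)))) =
        F.eval (1 / (p : ℝ)) / G.eval (1 / (p : ℝ)) := by
    have h_one := (h_half p hp).trans_lt one_half_lt_one
    exact Real.exp_log (div_pos (eval_pos hβF hF0 (by positivity) h_one)
      (eval_pos hβG hG0 (by positivity) h_one))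
  obtain ⟨Λ, h_sum_log, h_sum⟩ := exists_hasSum_and_hasSum_mul_logZeta
    (c := fun j => wittExp G j - wittExp F j) (by positivity) hβ hP hS
    (wittExp_sub_eq_zero_of_lt_two hF0 hG0 hX)
    (abs_wittExp_sub_le_mul_pow hβF hβG hβ hF0 hG0 hX) fun p hp => h_log p (hS p hp)
  rw [classPrimes_span] at h_sum_log
  exact ⟨Λ, h_sum_log.rexp.congr_fun fun p => (h_exp_log p p.2.2.1).symm, h_sum⟩

end

end EulerProd

theorem mainTheorem2_general (q : ℕ) [NeZero q] (A : EulerProd.LatticeClass q)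
    (F G : Polynomial ℝ)
    (hF0 : F.eval 0 = 1) (hG0 : G.eval 0 = 1) (hX : Polynomial.X ^ 2 ∣ F - G)
    (β : ℝ) (hβ : 2 ≤ β)
    (hβF : ∀ ρ ∈ F.aroots ℂ, ‖ρ⁻¹‖ ≤ β) (hβG : ∀ ρ ∈ G.aroots ℂ, ‖ρ⁻¹‖ ≤ β)
    (P : ℝ) (hP : 2 * β ≤ P) (J r : ℕ) (hJ : 3 ≤ J) (hr : 1 ≤ r) :
    Multipliable (fun p : EulerProd.PrimesIn P A =>
      F.eval (1 / (p.1 : ℝ)) / G.eval (1 / (p.1 : ℝ))) ∧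
    ∃ I : ℝ, 0 < I ∧
      ∏' p : EulerProd.PrimesIn P A, F.eval (1 / (p.1 : ℝ)) / G.eval (1 / (p.1 : ℝ)) =
        (∏ j ∈ Finset.Icc 2 J,
          EulerProd.zetaApprox P (j : ℝ) A r ^
            (EulerProd.wittExp G j - EulerProd.wittExp F j)) * I ∧
      |Real.log I| ≤
        (max F.natDegree G.natDegree : ℝ) *
          (((Nat.card (EulerProd.LatticeClass q) : ℝ) *
                ((EulerProd.expG q).divisors.card : ℝ) / 2) ^ (r - 1) *
              ((r : ℝ) * β ^ 2 / P ^ (2 ^ (r + 1))) * (1 + P / 2 ^ r) +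
            4 * β ^ (J + 1) / ((J : ℝ) * P ^ J)) := by
  open EulerProd in
  set M : ℝ := max (F.natDegree : ℝ) G.natDegree
  have hM : 0 ≤ M := by positivity
  obtain ⟨Λ, h_prod, h_sum⟩ :=
    exists_hasProd_and_hasSum_wittExp_mul_logZeta hβF hβG hβ hF0 hG0 hX hP A
  set Λ' := ∑ j ∈ Finset.Icc 2 J, (wittExp G j - wittExp F j) * approxVec q P j r A.span with hΛ'
  have h_zeta : ∏ j ∈ Finset.Icc 2 J, zetaApprox P (j : ℝ) A r ^ (wittExp G j - wittExp F j) =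
      Real.exp Λ' := by
    rw [hΛ', Real.exp_sum]
    exact Finset.prod_congr rfl fun j _ => by rw [zetaApprox, ← Real.exp_mul, mul_comm]
  refine ⟨h_prod.multipliable, Real.exp (Λ - Λ'), Real.exp_pos _, ?_, ?_⟩
  · rw [h_prod.tprod_eq, h_zeta, ← Real.exp_add, add_sub_cancel]
  · rw [Real.log_exp, mul_add]
    have h_c01 := wittExp_sub_eq_zero_of_lt_two hF0 hG0 hX
    refine (abs_sub_sum_Icc_le h_c01 h_sum _ J).trans (add_le_add ?_ ?_)
    · exact sum_abs_mul_logZeta_sub_approxVec_le hM hβ hP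
        (abs_wittExp_sub_le_mul_pow hβF hβG hβ hF0 hG0 hX) A.span J hr
    · exact abs_tsum_mul_logZeta_le hM hβ hP (fun p hp => hp.2.1)
        (abs_wittExp_sub_le hβF hβG hβ) hJ

theorem mainTheorem2 (q : ℕ) [NeZero q] (hq : 1 < q) (A : EulerProd.LatticeClass q)
    (F G : Polynomial ℝ) (hFG : IsCoprime F G)
    (hF0 : F.eval 0 = 1) (hG0 : G.eval 0 = 1) (hX : Polynomial.X ^ 2 ∣ F - G)
    (β : ℝ) (hβ : 2 ≤ β)
    (hβF : ∀ ρ ∈ F.aroots ℂ, ‖ρ⁻¹‖ ≤ β) (hβG : ∀ ρ ∈ G.aroots ℂ, ‖ρ⁻¹‖ ≤ β)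
    (P : ℝ) (hP : 2 * β ≤ P) (J r : ℕ) (hJ : 3 ≤ J) (hr : 2 ≤ r) :
    Multipliable (fun p : EulerProd.PrimesIn P A =>
      F.eval (1 / (p.1 : ℝ)) / G.eval (1 / (p.1 : ℝ))) ∧
    ∃ I : ℝ, 0 < I ∧
      ∏' p : EulerProd.PrimesIn P A, F.eval (1 / (p.1 : ℝ)) / G.eval (1 / (p.1 : ℝ)) =
        (∏ j ∈ Finset.Icc 2 J,
          EulerProd.zetaApprox P (j : ℝ) A r ^
            (EulerProd.wittExp G j - EulerProd.wittExp F j)) * I ∧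
      |Real.log I| ≤
        (max F.natDegree G.natDegree : ℝ) *
          (((Nat.card (EulerProd.LatticeClass q) : ℝ) *
                ((EulerProd.expG q).divisors.card : ℝ) / 2) ^ (r - 1) *
              ((r : ℝ) * β ^ 2 / P ^ (2 ^ (r + 1))) * (1 + P / 2 ^ r) +
            4 * β ^ (J + 1) / ((J : ℝ) * P ^ J)) :=
  mainTheorem2_general q A F G hF0 hG0 hX β hβ hβF hβG P hP J r hJ (one_le_two.trans hr)
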